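/- **Setting.** Let $X_1\in\mathbb R^{n_1\times d}$ (points whose labels must be queried), $X_2\in\mathbb R^{n_2\times d}$ (points labelled in advance), with arbitrary labels $Y_1\in\mathbb R^{n_1}$, $Y_2\in\mathbb R^{n_2}$, and let $X=\begin{bmatrix}X_1\\X_2\end{bmatrix}$, $Y=\begin{bmatrix}Y_1\\Y_2\end{bmatrix}$. Let $X=U\Sigma V^T$ be a compact singular value decomposition, $U\in\mathbb R^{(n_1+n_2)\times r}$, $r=\operatorname{rank}X$ ($r=d$ if $X$ has full column rank), and let $U(x)\in\mathbb R^r$ be the row of $U$ that belongs to the row $x$ of $X$. **The sampler ASURA** (input $X$, $0<\epsilon<1$, constant $C_0$). Put $\gamma=\sqrt\epsilon/C_0$, $u_0=2r/\gamma$, $l_0=-2r/\gamma$, $A_0=0\in\mathbb R^{r\times r}$, $j=0$. While $(u_j-l_j)+\sum_{i<j}\Phi_i<8r/\gamma$: let $B_j=(u_jI-A_j)^{-1}+(A_j-l_jI)^{-1}$ and $\Phi_j=\mathsf{Tr}(B_j)$; sample a row $x_j$ of $X$, where $x$ has probability $p_x=U(x)^TB_jU(x)/\Phi_j$; put $w_j'=\frac{\gamma}{\Phi_j\,p_{x_j}}$,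 $A_{j+1}=A_j+w_j'\,U(x_j)U(x_j)^T$, $u_{j+1}=u_j+\frac{\gamma}{(1-2\gamma)\Phi_j}$, $l_{j+1}=l_j+\frac{\gamma}{(1+2\gamma)\Phi_j}$; increase $j$ by one. When the loop ends, let $m=j$, and return the sampled rows with the weights $w_j=w_j'/\mathsf{mid}$, $\mathsf{mid}=(u_m+l_m)/2$. **The regression algorithm** runs ASURA, queries the label of each sampled row that lies in $X_1$, and returns a minimiser $\widehat\beta$ of $\sum_j w_j(\beta^Tx_j-y_j)^2$, where $y_j$ is the label of $x_j$. Let $W_S$ be the diagonal matrix whose entry at row $x$ is $\big(\sum_{j:\,x_j=x}w_j\big)^{1/2}$, and let $S$ be its support. **Theorem.** For every $p\in(0,1)$ and every sufficiently large constant $C_0\ge C_{\min}(p)$ there is a constant $C>0$, depending only on $p$ and $C_0$, such that the following holds for all sizes, data and labels and all $0<\epsilon<1$. 1. If $X$ has full column rank, put $\mathsf R_X=\mathsf{Tr}\big((X^TX)^{-1}X_1^TX_1\big)$. With probability at least $p$, ASURA terminates and - at most $C\,\mathsf R_X/\epsilon$ labels of points in $X_1$ are queried (counting repetitions); - $|S|\le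 C\,d/\epsilon$; - $\sum_j w_j(\beta^Tx_j-y_j)^2=\|W_S(X\beta-Y)\|_2^2$ for all $\beta$; this function of $\beta$ has a minimiser, and every minimiser $\widehat\beta$ of it satisfies $$\|X\widehat\beta-Y\|_2^2\le(1+C\epsilon)\min_{\beta\in\mathbb R^d}\|X\beta-Y\|_2^2 .$$ 2. (Ridge regression.) Let $\lambda\ge0$ and let $X_1\in\mathbb R^{n\times d}$, $Y_1\in\mathbb R^n$ be arbitrary. The same conclusions hold for $X_2=\sqrt\lambda\,I_d$, $Y_2=0$, for which $\|X\beta-Y\|_2^2=\|X_1\beta-Y_1\|_2^2+\lambda\|\beta\|_2^2$, and the number of queries is at most $C\,\mathsf{sd}_\lambda(X_1)/\epsilon$, where $\mathsf{sd}_\lambda(X_1)=\sum_{i=1}^{\operatorname{rank}X_1}\frac1{1+\lambda/\sigma_i^2}$ and $\sigma_1\ge\sigma_2\ge\cdots$ are the singular values of $X_1$. 3. (Kernel ridge regression.) Let $\lambda\ge0$, let $K\in\mathbb R^{N\times N}$ be symmetric positive semidefinite, $Y_1\in\mathbb R^N$, and let $Z\in\mathbb R^{N\times N}$ satisfy $Z^TZ=K$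 (for example $Z=\sqrt K$). The same conclusions, with $d=N$, hold for $X_1=K$, $X_2=\sqrt\lambda\,Z$, $Y_2=0$, for which $\|X\beta-Y\|_2^2=\|K\beta-Y_1\|_2^2+\lambda\,\beta^TK\beta$, and the number of queries is at most $C\,d_\lambda(K)/\epsilon$, where $d_\lambda(K)=\sum_\theta\frac1{1+\lambda/\theta}$ over the nonzero eigenvalues $\theta$ of $K$, with multiplicity. -/

import Mathlib

open Matrix
open scoped ENNReal

noncomputable section

/-- The squared Euclidean norm of a real vector. -/
def sqNorm {ι : Type*} [Fintype ι] (v : ι → ℝ) : ℝ := ∑ i, v i ^ 2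

/-- `X = U Σ Vᵀ` is a compact singular value decomposition of `X`: `U` and `V` have orthonormal
columns and `Σ = diag σ` with all `σ k > 0` (so `r` is the rank of `X`, and `r = d` when `X` has
full column rank). -/
structure IsCompactSVD {ι : Type*} [Fintype ι] {d r : ℕ} (X : Matrix ι (Fin d) ℝ)
    (U : Matrix ι (Fin r) ℝ) (σ : Fin r → ℝ) (V : Matrix (Fin d) (Fin r) ℝ) : Prop where
  orthonormal_left : Uᵀ * U = 1
  orthonormal_right : Vᵀ * V = 1
  pos : ∀ k, 0 < σ k
  factor : X = U * Matrix.diagonal σ * Vᵀ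

/-- The reduced rank `Tr ((Xᵀ X)⁻¹ X₁ᵀ X₁)`, where `X` is `X₁` stacked on `X₂`. -/
def reducedRank {n₁ n₂ d : ℕ} (X₁ : Matrix (Fin n₁) (Fin d) ℝ) (X₂ : Matrix (Fin n₂) (Fin d) ℝ) :
    ℝ :=
  Matrix.trace (((Matrix.fromRows X₁ X₂)ᵀ * Matrix.fromRows X₁ X₂)⁻¹ * (X₁ᵀ * X₁))

/-- The statistical dimension: the sum of `1 / (1 + lam / σᵢ²)` over the first `rank X₁`
singular values `σᵢ` of `X₁`. -/
def statisticalDim {n d : ℕ} (X₁ : Matrix (Fin n) (Fin d) ℝ) (lam : ℝ) : ℝ :=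
  ∑ i ∈ Finset.range X₁.rank, 1 / (1 + lam / (Matrix.toEuclideanLin X₁).singularValues i ^ 2)

/-- The effective dimension: the sum of `1 / (1 + lam / θ)` over the nonzero eigenvalues `θ` of `K`,
counted with multiplicity (there are `rank K` of them). -/
def effectiveDim {N : ℕ} {K : Matrix (Fin N) (Fin N) ℝ} (hK : K.IsHermitian) (lam : ℝ) : ℝ :=
  ∑ i with hK.eigenvalues i ≠ 0, 1 / (1 + lam / hK.eigenvalues i)

/-- The variables of the sampler before iteration `j`: the matrix `A_j`, the thresholds
`u_j` and `l_j`, the sum of the potentials of the iterations before `j`, and the list of the points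
sampled so far (as row indices, the latest first) with their unnormalised weights. -/
structure AsuraState (ι : Type*) (r : ℕ) where
  A : Matrix (Fin r) (Fin r) ℝ
  u : ℝ
  l : ℝ
  phiSum : ℝ
  samples : List (ι × ℝ)

namespace Asura

variable {ι : Type*} {r : ℕ}

/-- The matrix `(u I - A)⁻¹ + (A - l I)⁻¹`. -/
def barrier (s : AsuraState ι r) : Matrix (Fin r) (Fin r) ℝ :=
  (s.u • (1 : Matrix (Fin r) (Fin r) ℝ) - s.A)⁻¹ + (s.A - s.l • (1 : Matrix (Fin r) (Fin r) ℝ))⁻¹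

/-- The potential `Tr ((u I - A)⁻¹ + (A - l I)⁻¹)`. -/
def potential (s : AsuraState ι r) : ℝ := Matrix.trace (barrier s)

/-- The probability with which the row `x` is sampled next. -/
def pointProb (U : Matrix ι (Fin r) ℝ) (s : AsuraState ι r) (x : ι) : ℝ :=
  (U x ⬝ᵥ barrier s *ᵥ U x) / potential s

/-- The initial state. -/
def init (ι : Type*) (r : ℕ) (γ : ℝ) : AsuraState ι r where
  A := 0
  u := 2 * r / γ
  l := -(2 * r / γ)
  phiSum := 0
  samples := []

/-- The condition of the while loop. -/
def Continues (γ : ℝ) (s : AsuraState ι r) : Prop :=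
  (s.u - s.l) + s.phiSum < 8 * r / γ

/-- The body of the while loop, once the point `x` has been sampled. -/
def update (U : Matrix ι (Fin r) ℝ) (γ : ℝ) (s : AsuraState ι r) (x : ι) : AsuraState ι r where
  A := s.A + (γ / potential s * (1 / pointProb U s x)) • Matrix.vecMulVec (U x) (U x)
  u := s.u + γ / (1 - 2 * γ) * (1 / potential s)
  l := s.l + γ / (1 + 2 * γ) * (1 / potential s)
  phiSum := s.phiSum + potential s
  samples := (x, γ / potential s * (1 / pointProb U s x)) :: s.samples

open Classical in
/-- The multinomial distribution with probabilities `pointProb U s`. The outcome `none` records that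
these numbers are not a probability vector; a run in which this happens counts as failed. -/
def sampleDist [Fintype ι] (U : Matrix ι (Fin r) ℝ) (s : AsuraState ι r) : PMF (Option ι) :=
  if h : (∀ x, 0 ≤ pointProb U s x) ∧ ∑ x, pointProb U s x = 1 then
    (PMF.ofFintype (fun x => ENNReal.ofReal (pointProb U s x)) (by
      rw [← ENNReal.ofReal_sum_of_nonneg (fun x _ => h.1 x), h.2, ENNReal.ofReal_one])).map some
  else PMF.pure none

open Classical in
/-- One pass through the while loop; a state in which the loop has ended is kept. -/
def step [Fintype ι] (U : Matrix ι (Fin r) ℝ) (γ : ℝ) (s : AsuraState ι r) :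
    PMF (Option (AsuraState ι r)) :=
  if Continues γ s then (sampleDist U s).map (Option.map (update U γ s)) else PMF.pure (some s)

/-- The law of the state of the sampler after at most `k` iterations. -/
def stateAfter [Fintype ι] (U : Matrix ι (Fin r) ℝ) (γ : ℝ) : ℕ → PMF (Option (AsuraState ι r))
  | 0 => PMF.pure (some (init ι r γ))
  | k + 1 => (stateAfter U γ k).bind fun o =>
      match o with
      | none => PMF.pure none
      | some s => step U γ s

/-- The probability that the while loop ends, in a state satisfying `P`. The probability that it has
done so within `k` iterations is nondecreasing in `k`, so its limit is the supremum. -/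
def outputProb [Fintype ι] (U : Matrix ι (Fin r) ℝ) (γ : ℝ) (P : AsuraState ι r → Prop) : ℝ≥0∞ :=
  ⨆ k, (stateAfter U γ k).toOuterMeasure {o | ∃ s, o = some s ∧ ¬ Continues γ s ∧ P s}

/-- The normalisation `mid = (u_m + l_m) / 2`. -/
def mid (s : AsuraState ι r) : ℝ := (s.u + s.l) / 2

/-- The returned points `x₁, …, x_m` with the returned weights `w₁, …, w_m`. -/
def output (s : AsuraState ι r) : List (ι × ℝ) := s.samples.map fun q => (q.1, q.2 / mid s)

end Asura

/-- The number of label queries made for the rows of `X₁`: one for each returned point of `X₁`,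
repetitions included. -/
def labelQueries {n₁ n₂ : ℕ} (out : List ((Fin n₁ ⊕ Fin n₂) × ℝ)) : ℕ :=
  out.countP fun q => q.1.isLeft

/-- The objective `∑ᵢ wᵢ (βᵀ xᵢ - yᵢ)²` minimised by the semi-supervised active regression
algorithm over the returned points and weights. -/
def sampledLoss {ι : Type*} {d : ℕ} (X : Matrix ι (Fin d) ℝ) (Y : ι → ℝ) (out : List (ι × ℝ))
    (β : Fin d → ℝ) : ℝ :=
  (out.map fun q => q.2 * (X q.1 ⬝ᵥ β - Y q.1) ^ 2).sum

open Classical in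
/-- The diagonal weight matrix `W_S`: the square of the entry at `x` is the total weight that the
output gives to `x`. -/
def weightMatrix {ι : Type*} (out : List (ι × ℝ)) : Matrix ι ι ℝ :=
  Matrix.diagonal fun x => √((out.map fun q => if q.1 = x then q.2 else 0).sum)

/-- The support `S` of the weight matrix. -/
def weightSupport {ι : Type*} (out : List (ι × ℝ)) : Set ι := {x | weightMatrix out x x ≠ 0}

/-- The output `out` of the sampler on the data `X` with labels `Y` is good, with constant `C`, for
the query bound `R` and for the objective `loss`: at most `C * R / ε` labels of `X₁` are queried,
`W_S` has at most `C * d / ε` nonzero entries, the loss that the algorithm minimises is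
`‖W_S (X β - Y)‖²`, it has a minimiser, and every minimiser `βhat` of it is a `1 + C * ε`
approximate minimiser of `loss`. -/
structure IsGoodOutput {n₁ n₂ d : ℕ} (X : Matrix (Fin n₁ ⊕ Fin n₂) (Fin d) ℝ)
    (Y : Fin n₁ ⊕ Fin n₂ → ℝ) (loss : (Fin d → ℝ) → ℝ) (R C ε : ℝ)
    (out : List ((Fin n₁ ⊕ Fin n₂) × ℝ)) : Prop where
  queries : (labelQueries out : ℝ) ≤ C * (R / ε)
  support : ((weightSupport out).ncard : ℝ) ≤ C * (d / ε)
  loss_eq : ∀ β, sampledLoss X Y out β = sqNorm (weightMatrix out *ᵥ (X *ᵥ β - Y))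
  exists_min : ∃ βhat, ∀ β, sqNorm (weightMatrix out *ᵥ (X *ᵥ βhat - Y)) ≤
    sqNorm (weightMatrix out *ᵥ (X *ᵥ β - Y))
  approx : ∀ βhat, (∀ β, sqNorm (weightMatrix out *ᵥ (X *ᵥ βhat - Y)) ≤
    sqNorm (weightMatrix out *ᵥ (X *ᵥ β - Y))) → ∀ β, loss βhat ≤ (1 + C * ε) * loss β

end

/-! ### Quadratic forms of inverses: Loewner order, rank-one updates, scalar shifts. -/

namespace Matrix

variable {n : Type*} [Fintype n] {M N : Matrix n n ℝ}

/-! Since `X = U (Σ Vᵀ)` with `Σ Vᵀ` onto, regression on `X` is regression on `U`. There the optimum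
is `UᵀY`, and its residual `e` is orthogonal to the columns of `U`. At `UᵀY + δ` the true loss is
`|δ|² + |e|²`, and the sampled loss is a constant minus `2 g·δ` plus `δᵀGδ`, where `G = A_m / mid`
and `g` is the weighted sum of the `e(x_j) U(x_j)`. If `G ≥ 1/2`, every sampled minimiser has `|δ|²
≤ 16 |g|²` (`isGoodOutput_of_sampledGram`). So `|g|² = O(ε) |e|²` suffices.

Deterministically `l_j < A_j < u_j` and `u_j - l_j = 4r/γ + 4γ mid`, so `G ≥ 1/2` as soon as `mid`
is at least a suitable multiple of `r/γ²`. By AM-GM each iteration advances the loop counter by at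
least `4γ`, so there are at most about `r/γ²` samples. While the loop runs, `u - l < 8r/γ` gives
`B_j ≥ γ/(2r)`, hence `Φ_j ≥ γ/2`.

The probabilistic core is that `B_j` is a supermartingale in the Loewner order, started at `(γ/r)
I`: the shifts of `u` and `l` pay for the rank-one update. Three Markov bounds follow. (a) The
expected sum of `k` potentials is at most `kγ`. Since `mid` grows by at least `γ/Φ_j`,
Cauchy-Schwarz turns a small sum of potentials into a large `mid`. (b) A row of `X₁` is drawn with
probability at most `2/γ` times its part of the potential, so the expected number of queries is of
order `γ⁻²` times the total leverage of `X₁`. (c) The increments of the unnormalised `g` have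
conditional mean zero because `Uᵀe = 0`. Their second moments are at most `2r |e|²` times the
increments of `mid`, which is bounded.

The total leverage of `X₁` equals the reduced rank, the statistical dimension or the effective
dimension in the three settings. -/

theorem dotProduct_mulVec_comm (hM : M.IsHermitian) (x y : n → ℝ) :
    x ⬝ᵥ M *ᵥ y = y ⬝ᵥ M *ᵥ x := by
  have h : Mᵀ = M := by rw [← conjTranspose_eq_transpose_of_trivial, hM.eq]
  rw [dotProduct_comm, ← h, mulVec_transpose, ← dotProduct_mulVec, h]

theorem posDef_of_real (hM : M.IsHermitian) (h : ∀ x ≠ 0, 0 < x ⬝ᵥ M *ᵥ x) : M.PosDef :=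
  PosDef.of_dotProduct_mulVec_pos hM fun x hx => by simpa using h x hx

theorem PosDef.quad_pos (hM : M.PosDef) {x : n → ℝ} (hx : x ≠ 0) : 0 < x ⬝ᵥ M *ᵥ x := by
  simpa using hM.dotProduct_mulVec_pos hx

theorem PosDef.quad_nonneg (hM : M.PosDef) (x : n → ℝ) : 0 ≤ x ⬝ᵥ M *ᵥ x := by
  simpa using hM.posSemidef.dotProduct_mulVec_nonneg x

variable [DecidableEq n]

theorem PosDef.mulVec_inv_mulVec (hM : M.PosDef) (x : n → ℝ) : M *ᵥ (M⁻¹ *ᵥ x) = x := by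
  rw [mulVec_mulVec, mul_nonsing_inv _ ((isUnit_iff_isUnit_det _).1 hM.isUnit), one_mulVec]

theorem PosDef.inv_mulVec_mulVec (hM : M.PosDef) (x : n → ℝ) : M⁻¹ *ᵥ (M *ᵥ x) = x := by
  rw [mulVec_mulVec, nonsing_inv_mul _ ((isUnit_iff_isUnit_det _).1 hM.isUnit), one_mulVec]

/-- The quadratic form of the inverse dominates its variational lower bounds. -/
theorem PosDef.two_mul_dotProduct_sub_le (hM : M.PosDef) (v y : n → ℝ) :
    2 * (v ⬝ᵥ y) - y ⬝ᵥ M *ᵥ y ≤ v ⬝ᵥ M⁻¹ *ᵥ v := by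
  have h := hM.quad_nonneg (y - M⁻¹ *ᵥ v)
  rw [mulVec_sub, hM.mulVec_inv_mulVec, dotProduct_sub, sub_dotProduct, sub_dotProduct,
    dotProduct_mulVec_comm hM.isHermitian (M⁻¹ *ᵥ v), hM.mulVec_inv_mulVec,
    dotProduct_comm (M⁻¹ *ᵥ v)] at h
  linarith [dotProduct_comm v y]

/-- Cauchy-Schwarz between the dual norms of `M` and `M⁻¹`, as the discriminant of the variational
bound along the line `t • y`. -/
theorem PosDef.dotProduct_sq_le (hM : M.PosDef) (v y : n → ℝ) :
    (v ⬝ᵥ y) ^ 2 ≤ (v ⬝ᵥ M⁻¹ *ᵥ v) * (y ⬝ᵥ M *ᵥ y) := by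
  have h : ∀ t : ℝ, 0 ≤ (y ⬝ᵥ M *ᵥ y) * (t * t) + (-2 * (v ⬝ᵥ y)) * t + v ⬝ᵥ M⁻¹ *ᵥ v := by
    intro t
    have := hM.two_mul_dotProduct_sub_le v (t • y)
    simp only [mulVec_smul, dotProduct_smul, smul_dotProduct, smul_eq_mul] at this
    linarith
  have := discrim_le_zero h
  rw [discrim] at this
  linarith

/-- Inversion reverses the Loewner order: test the variational bound for `M` at `c • N⁻¹ v`. -/
theorem PosDef.mul_quad_inv_le (hM : M.PosDef) (hN : N.PosDef) {c : ℝ} (hc : 0 ≤ c)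
    (h : ∀ y, c * (y ⬝ᵥ M *ᵥ y) ≤ y ⬝ᵥ N *ᵥ y) (v : n → ℝ) :
    c * (v ⬝ᵥ N⁻¹ *ᵥ v) ≤ v ⬝ᵥ M⁻¹ *ᵥ v := by
  have h1 := hM.two_mul_dotProduct_sub_le v (c • (N⁻¹ *ᵥ v))
  have h2 := h (N⁻¹ *ᵥ v)
  rw [hN.mulVec_inv_mulVec, dotProduct_comm (N⁻¹ *ᵥ v) v] at h2
  simp only [mulVec_smul, dotProduct_smul, smul_dotProduct, smul_eq_mul] at h1
  nlinarith [mul_le_mul_of_nonneg_left h2 hc]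

/-- The smallest eigenvalue of `M` is at least `1 / Tr M⁻¹`. Here it comes from Cauchy-Schwarz
against each unit vector. -/
theorem PosDef.dotProduct_self_le_trace_inv (hM : M.PosDef) (y : n → ℝ) :
    y ⬝ᵥ y ≤ M⁻¹.trace * (y ⬝ᵥ M *ᵥ y) := by
  rw [trace, Finset.sum_mul, dotProduct]
  refine Finset.sum_le_sum fun i _ => ?_
  have := hM.dotProduct_sq_le (Pi.single i 1) y
  simpa [sq] using this

theorem PosDef.add_smul_vecMulVec (hM : M.PosDef) {c : ℝ} {v : n → ℝ}
    (h : 0 < 1 + c * (v ⬝ᵥ M⁻¹ *ᵥ v)) : (M + c • vecMulVec v v).PosDef := by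
  refine posDef_of_real (hM.isHermitian.add ?_) fun x hx => ?_
  · ext i j; simp [vecMulVec, mul_comm (v i)]
  · have hq : x ⬝ᵥ (M + c • vecMulVec v v) *ᵥ x = x ⬝ᵥ M *ᵥ x + c * (v ⬝ᵥ x) ^ 2 := by
      simp [add_mulVec, smul_mulVec, dotProduct_add, vecMulVec_mulVec, dotProduct_comm x v, sq]
    rw [hq]
    have h1 := hM.dotProduct_sq_le v x
    have h2 := hM.quad_pos hx
    rcases le_or_gt 0 c with hc | hc
    · positivity
    -- For negative `c` (the upper barrier), Cauchy-Schwarz bounds what the rank-one term removes by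
    -- a fraction below one of the form of `M`.
    · nlinarith [mul_pos h h2]

/-- Sherman-Morrison: the candidate `a` for the new inverse applied to `z` is checked by multiplying
back. -/
theorem PosDef.quad_inv_add_smul_vecMulVec (hM : M.PosDef) {c : ℝ} {v : n → ℝ}
    (h : 0 < 1 + c * (v ⬝ᵥ M⁻¹ *ᵥ v)) (z : n → ℝ) :
    z ⬝ᵥ (M + c • vecMulVec v v)⁻¹ *ᵥ z = z ⬝ᵥ M⁻¹ *ᵥ z -
      c * (v ⬝ᵥ M⁻¹ *ᵥ z) ^ 2 / (1 + c * (v ⬝ᵥ M⁻¹ *ᵥ v)) := by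
  have hN := hM.add_smul_vecMulVec h
  set a := M⁻¹ *ᵥ z - (c * (v ⬝ᵥ M⁻¹ *ᵥ z) / (1 + c * (v ⬝ᵥ M⁻¹ *ᵥ v))) • M⁻¹ *ᵥ v with ha
  have hz : (M + c • vecMulVec v v) *ᵥ a = z := by
    simp only [ha, mulVec_sub, mulVec_smul, add_mulVec, hM.mulVec_inv_mulVec, smul_mulVec,
      vecMulVec_mulVec]
    ext i
    simp
    field_simp
    ring
  have : (M + c • vecMulVec v v)⁻¹ *ᵥ z = a := by
    rw [← hN.inv_mulVec_mulVec a, hz]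
  rw [this, ha, dotProduct_sub, dotProduct_smul, smul_eq_mul,
    dotProduct_mulVec_comm hM.isHermitian.inv z v]
  ring

theorem dotProduct_mulVec_add_smul_one (δ : ℝ) (y z : n → ℝ) :
    y ⬝ᵥ (M + δ • (1 : Matrix n n ℝ)) *ᵥ z = y ⬝ᵥ M *ᵥ z + δ * (y ⬝ᵥ z) := by
  simp [add_mulVec, smul_mulVec, dotProduct_add]

/-- The resolvent increment dominates the squared resolvent at the shifted matrix. -/
theorem PosDef.quad_inv_add_smul_one_add_le (hM : M.PosDef) {δ : ℝ}
    (hN : (M + δ • (1 : Matrix n n ℝ)).PosDef) (z : n → ℝ) :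
    z ⬝ᵥ (M + δ • (1 : Matrix n n ℝ))⁻¹ *ᵥ z + δ *
      (((M + δ • (1 : Matrix n n ℝ))⁻¹ *ᵥ z) ⬝ᵥ ((M + δ • (1 : Matrix n n ℝ))⁻¹ *ᵥ z)) ≤
      z ⬝ᵥ M⁻¹ *ᵥ z := by
  set y := (M + δ • (1 : Matrix n n ℝ))⁻¹ *ᵥ z with hy
  have hz : z = M *ᵥ y + δ • y := by
    have := hN.mulVec_inv_mulVec z
    rw [← hy] at this
    rw [← this]
    simp [add_mulVec, smul_mulVec]
  -- An exact expansion in `y`, whose last term is nonnegative for either sign of `δ`. The lower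
  -- barrier needs negative `δ`.
  have h1 : z ⬝ᵥ M⁻¹ *ᵥ z = z ⬝ᵥ y + δ * (y ⬝ᵥ y) + δ ^ 2 * (y ⬝ᵥ M⁻¹ *ᵥ y) := by
    have h2 : M⁻¹ *ᵥ z = y + δ • M⁻¹ *ᵥ y := by
      rw [hz, mulVec_add, hM.inv_mulVec_mulVec, mulVec_smul]
    rw [h2, dotProduct_add, dotProduct_smul, dotProduct_mulVec_comm hM.isHermitian.inv z y, h2,
      dotProduct_add, dotProduct_smul]
    simp only [smul_eq_mul]
    ring
  rw [h1]
  nlinarith [mul_nonneg (sq_nonneg δ) (hM.inv.quad_nonneg y)]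

end Matrix

/-! ### One iteration: the barriers are preserved and the barrier matrix decreases in expectation.
-/

namespace Asura

variable {ι : Type*} {r : ℕ}

/-- The spectrum of `A_j` lies strictly between `l_j` and `u_j`. -/
structure Balanced (s : AsuraState ι r) : Prop where
  upper : (s.u • (1 : Matrix (Fin r) (Fin r) ℝ) - s.A).PosDef
  lower : (s.A - s.l • (1 : Matrix (Fin r) (Fin r) ℝ)).PosDef

/-- The unnormalised weight given to `x` if it is sampled next. -/
noncomputable def weight (U : Matrix ι (Fin r) ℝ) (γ : ℝ) (s : AsuraState ι r) (x : ι) : ℝ :=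
  γ / potential s * (1 / pointProb U s x)

variable {U : Matrix ι (Fin r) ℝ} {γ : ℝ} {s : AsuraState ι r}

namespace Balanced

theorem posDef_barrier (h : Balanced s) : (barrier s).PosDef :=
  h.upper.inv.add h.lower.inv

theorem quad_barrier (z : Fin r → ℝ) : z ⬝ᵥ barrier s *ᵥ z =
    z ⬝ᵥ (s.u • (1 : Matrix (Fin r) (Fin r) ℝ) - s.A)⁻¹ *ᵥ z +
      z ⬝ᵥ (s.A - s.l • (1 : Matrix (Fin r) (Fin r) ℝ))⁻¹ *ᵥ z := by
  rw [barrier, add_mulVec, dotProduct_add]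

theorem potential_pos [NeZero r] (h : Balanced s) : 0 < potential s :=
  h.posDef_barrier.trace_pos

theorem pointProb_nonneg [NeZero r] (h : Balanced s) (x : ι) : 0 ≤ pointProb U s x :=
  div_nonneg (h.posDef_barrier.quad_nonneg _) h.potential_pos.le

theorem weight_eq [NeZero r] (h : Balanced s) (x : ι) :
    weight U γ s x = γ / (U x ⬝ᵥ barrier s *ᵥ U x) := by
  have := h.potential_pos.ne'
  rw [weight, pointProb]
  rcases eq_or_ne (U x ⬝ᵥ barrier s *ᵥ U x) 0 with h0 | h0
  · simp [h0]
  · field_simp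

theorem weight_nonneg [NeZero r] (h : Balanced s) (hγ : 0 ≤ γ) (x : ι) : 0 ≤ weight U γ s x := by
  rw [h.weight_eq]
  exact div_nonneg hγ (h.posDef_barrier.quad_nonneg _)

theorem weight_mul_quad_le [NeZero r] (h : Balanced s) (hγ : 0 ≤ γ) (x : ι) :
    weight U γ s x * (U x ⬝ᵥ barrier s *ᵥ U x) ≤ γ := by
  rw [h.weight_eq]
  rcases eq_or_ne (U x ⬝ᵥ barrier s *ᵥ U x) 0 with h0 | h0
  · simpa [h0] using hγ
  · rw [div_mul_cancel₀ _ h0]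

/-- Importance weighting: every nonzero row carries the same mass, so the expected increment of `A`
is `γ/Φ` times `UᵀU = I`. -/
theorem pointProb_mul_weight [NeZero r] (h : Balanced s) {x : ι} (hx : U x ≠ 0) :
    pointProb U s x * weight U γ s x = γ / potential s := by
  have := h.potential_pos.ne'
  have := (h.posDef_barrier.quad_pos hx).ne'
  rw [h.weight_eq, pointProb]
  field_simp

section Fintype

variable [Fintype ι]

theorem _root_.Asura.sum_quad_eq_trace (hU : Uᵀ * U = 1) (B : Matrix (Fin r) (Fin r) ℝ) :
    ∑ x, U x ⬝ᵥ B *ᵥ U x = B.trace := by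
  have : (U * B * Uᵀ).trace = B.trace := by
    rw [Matrix.mul_assoc, trace_mul_comm, Matrix.mul_assoc, hU, Matrix.mul_one]
  rw [← this, trace]
  refine Finset.sum_congr rfl fun x _ => ?_
  rw [diag_apply, Matrix.mul_assoc, mul_apply, dotProduct]
  rfl

theorem _root_.Asura.sum_dotProduct_mul (hU : Uᵀ * U = 1) (y z : Fin r → ℝ) :
    ∑ x, (U x ⬝ᵥ y) * (U x ⬝ᵥ z) = y ⬝ᵥ z := by
  have : (U *ᵥ y) ⬝ᵥ (U *ᵥ z) = y ⬝ᵥ z := by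
    rw [dotProduct_comm, dotProduct_mulVec, vecMul_mulVec, hU, vecMul_one, dotProduct_comm]
  rw [← this]
  rfl

theorem sum_pointProb [NeZero r] (hU : Uᵀ * U = 1) (h : Balanced s) : ∑ x, pointProb U s x = 1 := by
  simp only [pointProb]
  rw [← Finset.sum_div, sum_quad_eq_trace hU]
  exact div_self h.potential_pos.ne'

theorem sum_pointProb_mul_weight_mul_sq [NeZero r] (hU : Uᵀ * U = 1) (h : Balanced s)
    (y : Fin r → ℝ) :
    ∑ x, pointProb U s x * (weight U γ s x * (U x ⬝ᵥ y) ^ 2) = γ / potential s * (y ⬝ᵥ y) := by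
  rw [← sum_dotProduct_mul hU, Finset.mul_sum]
  refine Finset.sum_congr rfl fun x _ => ?_
  rcases eq_or_ne (U x) 0 with hx | hx
  · simp [hx]
  · rw [← mul_assoc, h.pointProb_mul_weight hx, sq]

end Fintype

theorem _root_.Asura.upper_update (x : ι) :
    (update U γ s x).u • (1 : Matrix (Fin r) (Fin r) ℝ) - (update U γ s x).A =
      (s.u • (1 : Matrix (Fin r) (Fin r) ℝ) - s.A +
        (γ / (1 - 2 * γ) * (1 / potential s)) • (1 : Matrix (Fin r) (Fin r) ℝ)) +
        (-weight U γ s x) • vecMulVec (U x) (U x) := by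
  simp only [update, weight, add_smul, neg_smul]
  abel

theorem _root_.Asura.lower_update (x : ι) :
    (update U γ s x).A - (update U γ s x).l • (1 : Matrix (Fin r) (Fin r) ℝ) =
      (s.A - s.l • (1 : Matrix (Fin r) (Fin r) ℝ) +
        (-(γ / (1 + 2 * γ) * (1 / potential s))) • (1 : Matrix (Fin r) (Fin r) ℝ)) +
        weight U γ s x • vecMulVec (U x) (U x) := by
  simp only [update, weight, add_smul, neg_smul]
  abel

theorem posDef_upper_add (h : Balanced s) {δ : ℝ} (hδ : 0 ≤ δ) :
    (s.u • (1 : Matrix (Fin r) (Fin r) ℝ) - s.A + δ • (1 : Matrix (Fin r) (Fin r) ℝ)).PosDef :=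
  h.upper.add_posSemidef (PosSemidef.one.smul hδ)

theorem quad_upper_add_le (h : Balanced s) {δ : ℝ} (hδ : 0 ≤ δ) (v : Fin r → ℝ) :
    v ⬝ᵥ (s.u • (1 : Matrix (Fin r) (Fin r) ℝ) - s.A +
      δ • (1 : Matrix (Fin r) (Fin r) ℝ))⁻¹ *ᵥ v ≤ v ⬝ᵥ barrier s *ᵥ v := by
  have h1 := h.upper.mul_quad_inv_le (h.posDef_upper_add hδ) zero_le_one (fun y => by
    rw [dotProduct_mulVec_add_smul_one, one_mul]
    have : 0 ≤ y ⬝ᵥ y := by simpa using dotProduct_star_self_nonneg y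
    nlinarith) v
  rw [quad_barrier]
  linarith [h.lower.inv.quad_nonneg v]

/-- The least eigenvalue of `A - l I` is at least `1 / Tr (A - l I)⁻¹ ≥ 1/Φ`, so raising `l` by
`τ/Φ` uses up at most the fraction `τ` of it. -/
theorem mul_quad_lower_le [NeZero r] (h : Balanced s) {τ : ℝ} (hτ : 0 ≤ τ) (y : Fin r → ℝ) :
    (1 - τ) * (y ⬝ᵥ (s.A - s.l • (1 : Matrix (Fin r) (Fin r) ℝ)) *ᵥ y) ≤
      y ⬝ᵥ (s.A - s.l • (1 : Matrix (Fin r) (Fin r) ℝ) +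
        (-(τ * (1 / potential s))) • (1 : Matrix (Fin r) (Fin r) ℝ)) *ᵥ y := by
  rw [dotProduct_mulVec_add_smul_one]
  have h1 := h.lower.dotProduct_self_le_trace_inv y
  have h2 : (s.A - s.l • (1 : Matrix (Fin r) (Fin r) ℝ))⁻¹.trace ≤ potential s := by
    rw [potential, barrier, trace_add]
    linarith [h.upper.inv.trace_pos]
  have h3 := h1.trans (mul_le_mul_of_nonneg_right h2 (h.lower.quad_nonneg y))
  have h4 : 1 / potential s * (y ⬝ᵥ y) ≤
      y ⬝ᵥ (s.A - s.l • (1 : Matrix (Fin r) (Fin r) ℝ)) *ᵥ y := by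
    rw [one_div, inv_mul_le_iff₀ h.potential_pos]
    exact h3
  nlinarith [mul_le_mul_of_nonneg_left h4 hτ]

theorem posDef_lower_sub [NeZero r] (h : Balanced s) {τ : ℝ} (hτ : 0 ≤ τ) (hτ1 : τ < 1) :
    (s.A - s.l • (1 : Matrix (Fin r) (Fin r) ℝ) +
      (-(τ * (1 / potential s))) • (1 : Matrix (Fin r) (Fin r) ℝ)).PosDef := by
  refine posDef_of_real (h.lower.isHermitian.add ?_) fun x hx => ?_
  · ext i j; rcases eq_or_ne i j with rfl | hij <;> simp [*, Ne.symm]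
  · exact (mul_pos (by linarith) (h.lower.quad_pos hx)).trans_le (h.mul_quad_lower_le hτ x)

theorem quad_lower_sub_le [NeZero r] (h : Balanced s) {τ : ℝ} (hτ : 0 ≤ τ) (hτ1 : τ < 1)
    (v : Fin r → ℝ) :
    (1 - τ) * (v ⬝ᵥ (s.A - s.l • (1 : Matrix (Fin r) (Fin r) ℝ) +
      (-(τ * (1 / potential s))) • (1 : Matrix (Fin r) (Fin r) ℝ))⁻¹ *ᵥ v) ≤
      v ⬝ᵥ barrier s *ᵥ v := by
  have h1 := h.lower.mul_quad_inv_le (h.posDef_lower_sub hτ hτ1) (by linarith)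
    (h.mul_quad_lower_le hτ) v
  rw [quad_barrier]
  linarith [h.upper.inv.quad_nonneg v]

theorem upper_shift_nonneg [NeZero r] (h : Balanced s) (hγ : 0 < γ) (hγ4 : γ ≤ 1 / 4) :
    0 ≤ γ / (1 - 2 * γ) * (1 / potential s) := by
  have := h.potential_pos
  have : 0 < 1 - 2 * γ := by linarith
  positivity

theorem weight_mul_upper_le [NeZero r] (h : Balanced s) (hγ : 0 < γ) (hγ4 : γ ≤ 1 / 4) (x : ι) :
    weight U γ s x * (U x ⬝ᵥ (s.u • (1 : Matrix (Fin r) (Fin r) ℝ) - s.A +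
        (γ / (1 - 2 * γ) * (1 / potential s)) • (1 : Matrix (Fin r) (Fin r) ℝ))⁻¹ *ᵥ U x) ≤ γ :=
  (mul_le_mul_of_nonneg_left (h.quad_upper_add_le (h.upper_shift_nonneg hγ hγ4) _)
    (h.weight_nonneg hγ.le x)).trans (h.weight_mul_quad_le hγ.le x)

theorem weight_mul_lower_le [NeZero r] (h : Balanced s) (hγ : 0 < γ) (x : ι) :
    weight U γ s x * (U x ⬝ᵥ (s.A - s.l • (1 : Matrix (Fin r) (Fin r) ℝ) +
        (-(γ / (1 + 2 * γ) * (1 / potential s))) • (1 : Matrix (Fin r) (Fin r) ℝ))⁻¹ *ᵥ U x) ≤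
      2 * γ := by
  -- Half of `A - l I` survives the shift, so its inverse at most doubles; this is the `2` in `2 *
  -- γ`.
  have hτ : γ / (1 + 2 * γ) ≤ 1 / 2 := by
    rw [div_le_iff₀ (by positivity)]; linarith
  have h1 := h.quad_lower_sub_le (τ := γ / (1 + 2 * γ)) (by positivity) (by linarith) (U x)
  have h2 := mul_le_mul_of_nonneg_left h1 (h.weight_nonneg (U := U) hγ.le x)
  have h3 := h.weight_mul_quad_le (U := U) hγ.le x
  have h4 := mul_nonneg (h.weight_nonneg (U := U) hγ.le x) ((h.posDef_lower_sub
    (τ := γ / (1 + 2 * γ)) (by positivity) (by linarith)).inv.quad_nonneg (U x))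
  nlinarith

theorem update [NeZero r] (h : Balanced s) (hγ : 0 < γ) (hγ4 : γ ≤ 1 / 4) (x : ι) :
    Balanced (update U γ s x) := by
  have hτ : γ / (1 + 2 * γ) < 1 := by
    rw [div_lt_one (by positivity)]; linarith
  have hM := h.posDef_lower_sub (τ := γ / (1 + 2 * γ)) (by positivity) hτ
  constructor
  · rw [upper_update]
    refine (h.posDef_upper_add (h.upper_shift_nonneg hγ hγ4)).add_smul_vecMulVec ?_
    linarith [h.weight_mul_upper_le (U := U) hγ hγ4 x]
  · rw [lower_update]
    refine hM.add_smul_vecMulVec ?_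
    have := mul_nonneg (h.weight_nonneg (U := U) hγ.le x) (hM.inv.quad_nonneg (U x))
    linarith

theorem quad_upper_update_le [NeZero r] (h : Balanced s) (hγ : 0 < γ) (hγ4 : γ ≤ 1 / 4) (x : ι)
    {N : Matrix (Fin r) (Fin r) ℝ} (hN : N = (s.u • (1 : Matrix (Fin r) (Fin r) ℝ) - s.A +
        (γ / (1 - 2 * γ) * (1 / potential s)) • (1 : Matrix (Fin r) (Fin r) ℝ))⁻¹)
    (z : Fin r → ℝ) :
    z ⬝ᵥ ((Asura.update U γ s x).u • (1 : Matrix (Fin r) (Fin r) ℝ) -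
        (Asura.update U γ s x).A)⁻¹ *ᵥ z ≤
      z ⬝ᵥ N *ᵥ z + 1 / (1 - γ) * (weight U γ s x * (U x ⬝ᵥ N *ᵥ z) ^ 2) := by
  have h1 := h.weight_mul_upper_le (U := U) hγ hγ4 x
  rw [upper_update, (h.posDef_upper_add (h.upper_shift_nonneg hγ hγ4)).quad_inv_add_smul_vecMulVec
    (by linarith), ← hN]
  rw [← hN] at h1
  have h2 : 0 ≤ weight U γ s x * (U x ⬝ᵥ N *ᵥ z) ^ 2 :=
    mul_nonneg (h.weight_nonneg hγ.le x) (sq_nonneg _)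
  have h3 : weight U γ s x * (U x ⬝ᵥ N *ᵥ z) ^ 2 / (1 + -weight U γ s x * (U x ⬝ᵥ N *ᵥ U x)) ≤
      weight U γ s x * (U x ⬝ᵥ N *ᵥ z) ^ 2 / (1 - γ) :=
    div_le_div_of_nonneg_left h2 (by linarith) (by linarith)
  rw [neg_mul, neg_div, one_div, inv_mul_eq_div]
  linarith

theorem quad_lower_update_le [NeZero r] (h : Balanced s) (hγ : 0 < γ) (x : ι)
    {N : Matrix (Fin r) (Fin r) ℝ} (hN : N = (s.A - s.l • (1 : Matrix (Fin r) (Fin r) ℝ) +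
        (-(γ / (1 + 2 * γ) * (1 / potential s))) • (1 : Matrix (Fin r) (Fin r) ℝ))⁻¹)
    (z : Fin r → ℝ) :
    z ⬝ᵥ ((Asura.update U γ s x).A -
        (Asura.update U γ s x).l • (1 : Matrix (Fin r) (Fin r) ℝ))⁻¹ *ᵥ z ≤
      z ⬝ᵥ N *ᵥ z - 1 / (1 + 2 * γ) * (weight U γ s x * (U x ⬝ᵥ N *ᵥ z) ^ 2) := by
  have hτ : γ / (1 + 2 * γ) < 1 := by
    rw [div_lt_one (by positivity)]; linarith
  have hM := h.posDef_lower_sub (τ := γ / (1 + 2 * γ)) (by positivity) hτ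
  have h1 := h.weight_mul_lower_le (U := U) hγ x
  have h0 := mul_nonneg (h.weight_nonneg (U := U) hγ.le x) (hM.inv.quad_nonneg (U x))
  rw [lower_update, hM.quad_inv_add_smul_vecMulVec (by linarith), ← hN]
  rw [← hN] at h1 h0
  have h2 : 0 ≤ weight U γ s x * (U x ⬝ᵥ N *ᵥ z) ^ 2 :=
    mul_nonneg (h.weight_nonneg hγ.le x) (sq_nonneg _)
  have h3 : weight U γ s x * (U x ⬝ᵥ N *ᵥ z) ^ 2 / (1 + 2 * γ) ≤
      weight U γ s x * (U x ⬝ᵥ N *ᵥ z) ^ 2 / (1 + weight U γ s x * (U x ⬝ᵥ N *ᵥ U x)) :=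
    div_le_div_of_nonneg_left h2 (by linarith) (by linarith)
  rw [one_div, inv_mul_eq_div]
  linarith

/-- The barrier matrix is a supermartingale in the Loewner order. -/
theorem sum_pointProb_mul_quad_barrier_update_le [Fintype ι] [NeZero r] (hU : Uᵀ * U = 1)
    (h : Balanced s) (hγ : 0 < γ) (hγ4 : γ ≤ 1 / 4) (z : Fin r → ℝ) :
    ∑ x, pointProb U s x * (z ⬝ᵥ barrier (Asura.update U γ s x) *ᵥ z) ≤ z ⬝ᵥ barrier s *ᵥ z := by
  have hτ : γ / (1 + 2 * γ) < 1 := by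
    rw [div_lt_one (by positivity)]; linarith
  have hu := h.upper.quad_inv_add_smul_one_add_le
    (h.posDef_upper_add (h.upper_shift_nonneg hγ hγ4)) z
  have hl := h.lower.quad_inv_add_smul_one_add_le
    (h.posDef_lower_sub (τ := γ / (1 + 2 * γ)) (by positivity) hτ) z
  obtain ⟨Nu, hNu⟩ : ∃ N, N = (s.u • (1 : Matrix (Fin r) (Fin r) ℝ) - s.A +
    (γ / (1 - 2 * γ) * (1 / potential s)) • (1 : Matrix (Fin r) (Fin r) ℝ))⁻¹ := ⟨_, rfl⟩
  obtain ⟨Nl, hNl⟩ : ∃ N, N = (s.A - s.l • (1 : Matrix (Fin r) (Fin r) ℝ) +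
    (-(γ / (1 + 2 * γ) * (1 / potential s))) • (1 : Matrix (Fin r) (Fin r) ℝ))⁻¹ := ⟨_, rfl⟩
  rw [← hNu] at hu
  rw [← hNl] at hl
  have hp := h.potential_pos
  have key : ∑ x, pointProb U s x * (z ⬝ᵥ barrier (Asura.update U γ s x) *ᵥ z) ≤
      ∑ x, ((z ⬝ᵥ Nu *ᵥ z + z ⬝ᵥ Nl *ᵥ z) * pointProb U s x +
        1 / (1 - γ) * (pointProb U s x * (weight U γ s x * (U x ⬝ᵥ Nu *ᵥ z) ^ 2)) -
        1 / (1 + 2 * γ) * (pointProb U s x * (weight U γ s x * (U x ⬝ᵥ Nl *ᵥ z) ^ 2))) := by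
    refine Finset.sum_le_sum fun x _ => ?_
    have h1 := h.quad_upper_update_le (U := U) hγ hγ4 x hNu z
    have h2 := h.quad_lower_update_le (U := U) hγ x hNl z
    have h3 := mul_le_mul_of_nonneg_left (add_le_add h1 h2) (h.pointProb_nonneg (U := U) x)
    rw [quad_barrier]
    linarith
  refine key.trans ?_
  rw [Finset.sum_sub_distrib, Finset.sum_add_distrib, ← Finset.mul_sum, ← Finset.mul_sum,
    ← Finset.mul_sum, h.sum_pointProb hU, h.sum_pointProb_mul_weight_mul_sq hU,
    h.sum_pointProb_mul_weight_mul_sq hU, quad_barrier]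
  -- Upper side: the expected cost of the rank-one update is below the gain from raising `u`, as `1
  -- - 2γ < 1 - γ`.
  have h4 : 1 / (1 - γ) * (γ / potential s * (Nu *ᵥ z ⬝ᵥ Nu *ᵥ z)) ≤
      γ / (1 - 2 * γ) * (1 / potential s) * (Nu *ᵥ z ⬝ᵥ Nu *ᵥ z) := by
    have h5 : 1 / (1 - γ) ≤ 1 / (1 - 2 * γ) := one_div_le_one_div_of_le (by linarith) (by linarith)
    have h6 : 0 ≤ Nu *ᵥ z ⬝ᵥ Nu *ᵥ z := by simpa using dotProduct_star_self_nonneg (Nu *ᵥ z)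
    have h7 := mul_le_mul_of_nonneg_right h5
      (show 0 ≤ γ / potential s * (Nu *ᵥ z ⬝ᵥ Nu *ᵥ z) by positivity)
    refine h7.trans_eq ?_
    ring
  -- Lower side: the cost of raising `l` is exactly the guaranteed gain from the rank-one update.
  have h8 : γ / (1 + 2 * γ) * (1 / potential s) * (Nl *ᵥ z ⬝ᵥ Nl *ᵥ z) =
      1 / (1 + 2 * γ) * (γ / potential s * (Nl *ᵥ z ⬝ᵥ Nl *ᵥ z)) := by ring
  linarith

/-- The barrier matrix is at least `4 / (u - l)` in the Loewner order. -/
theorem quad_barrier_ge (h : Balanced s) (hul : 0 < s.u - s.l) (z : Fin r → ℝ) :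
    4 / (s.u - s.l) * (z ⬝ᵥ z) ≤ z ⬝ᵥ barrier s *ᵥ z := by
  -- Matrix form of `1/a + 1/b ≥ 4/(a + b)`. The common test vector is the optimal one when `A` is
  -- the midpoint of the barriers.
  have h1 := h.upper.two_mul_dotProduct_sub_le z ((2 / (s.u - s.l)) • z)
  have h2 := h.lower.two_mul_dotProduct_sub_le z ((2 / (s.u - s.l)) • z)
  have h3 : z ⬝ᵥ (s.u • (1 : Matrix (Fin r) (Fin r) ℝ) - s.A) *ᵥ z +
      z ⬝ᵥ (s.A - s.l • (1 : Matrix (Fin r) (Fin r) ℝ)) *ᵥ z = (s.u - s.l) * (z ⬝ᵥ z) := by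
    simp [sub_mulVec, smul_mulVec, dotProduct_sub]
    ring
  rw [quad_barrier]
  simp only [mulVec_smul, dotProduct_smul, smul_dotProduct, smul_eq_mul] at h1 h2
  have h4 : 2 / (s.u - s.l) * (2 / (s.u - s.l) * ((s.u - s.l) * (z ⬝ᵥ z))) =
      4 / (s.u - s.l) * (z ⬝ᵥ z) := by
    field_simp
    ring
  have h5 : 2 / (s.u - s.l) * 2 = 4 / (s.u - s.l) := by ring
  rw [← h3] at h4
  linear_combination h1 + h2 + h4 - 2 * (z ⬝ᵥ z) * h5

theorem potential_ge (h : Balanced s) (hul : 0 < s.u - s.l) :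
    4 / (s.u - s.l) * r ≤ potential s := by
  have h1 : ∀ i, 4 / (s.u - s.l) ≤ barrier s i i := fun i => by
    simpa using h.quad_barrier_ge hul (Pi.single i 1)
  have h2 := Finset.sum_le_sum fun i (_ : i ∈ Finset.univ) => h1 i
  rw [Finset.sum_const, Finset.card_univ, Fintype.card_fin, nsmul_eq_mul, mul_comm] at h2
  exact h2

end Balanced
end Asura

/-! ### Deterministic invariants along a run. -/

namespace Asura

variable {ι : Type*} {r : ℕ} {U : Matrix ι (Fin r) ℝ} {γ : ℝ} {s : AsuraState ι r}

/-- The deterministic facts about the states that the sampler can reach. -/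
structure Reachable (U : Matrix ι (Fin r) ℝ) (γ : ℝ) (s : AsuraState ι r) : Prop where
  balanced : Balanced s
  A_eq : s.A = (s.samples.map fun q => q.2 • vecMulVec (U q.1) (U q.1)).sum
  weight_nonneg : ∀ q ∈ s.samples, 0 ≤ q.2
  gap : s.u - s.l = 4 * r / γ + 4 * γ * mid s
  phiSum_nonneg : 0 ≤ s.phiSum
  progress : 4 * r / γ + 4 * γ * s.samples.length ≤ s.u - s.l + s.phiSum
  sq_length_le : γ * s.samples.length ^ 2 ≤ s.phiSum * mid s
  mid_nonneg : 0 ≤ mid s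
  mid_le : mid s ≤ 5 * r / (4 * γ ^ 2)

theorem mid_update (hγ : 0 < γ) (hγ4 : γ ≤ 1 / 4) (x : ι) :
    mid (update U γ s x) = mid s + γ / (1 - 4 * γ ^ 2) * (1 / potential s) := by
  have h1 : 1 - 2 * γ ≠ 0 := by linarith
  have h2 : 1 + 2 * γ ≠ 0 := by linarith
  have h3 : γ / (1 - 4 * γ ^ 2) = (γ / (1 - 2 * γ) + γ / (1 + 2 * γ)) / 2 := by
    rw [show 1 - 4 * γ ^ 2 = (1 - 2 * γ) * (1 + 2 * γ) by ring, div_add_div _ _ h1 h2, div_div,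
      div_eq_div_iff (mul_ne_zero h1 h2) (mul_ne_zero (mul_ne_zero h1 h2) two_ne_zero)]
    ring
  rw [h3]
  simp only [mid, update]
  ring

theorem gap_update (hγ : 0 < γ) (hγ4 : γ ≤ 1 / 4) (x : ι) :
    (update U γ s x).u - (update U γ s x).l =
      s.u - s.l + 4 * γ * (γ / (1 - 4 * γ ^ 2) * (1 / potential s)) := by
  have h1 : 1 - 2 * γ ≠ 0 := by linarith
  have h2 : 1 + 2 * γ ≠ 0 := by linarith
  have h3 : 4 * γ * (γ / (1 - 4 * γ ^ 2)) = γ / (1 - 2 * γ) - γ / (1 + 2 * γ) := by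
    rw [show 1 - 4 * γ ^ 2 = (1 - 2 * γ) * (1 + 2 * γ) by ring, div_sub_div _ _ h1 h2, mul_div,
      div_eq_div_iff (mul_ne_zero h1 h2) (mul_ne_zero h1 h2)]
    ring
  rw [← mul_assoc, h3]
  simp only [update]
  ring

theorem le_div_one_sub (hγ : 0 < γ) (hγ4 : γ ≤ 1 / 4) : γ ≤ γ / (1 - 4 * γ ^ 2) := by
  have : 0 < 1 - 4 * γ ^ 2 := by nlinarith
  rw [le_div_iff₀ this]
  nlinarith [pow_pos hγ 3]

theorem balanced_init [NeZero r] (hγ : 0 < γ) : Balanced (init ι r γ) := by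
  have hr : (0 : ℝ) < r := by exact_mod_cast NeZero.pos r
  have h : (0 : ℝ) < 2 * r / γ := by positivity
  constructor
  · simpa [init] using PosDef.one.smul h
  · simpa [init] using PosDef.one.smul h

theorem reachable_init [NeZero r] (hγ : 0 < γ) : Reachable U γ (init ι r γ) where
  balanced := balanced_init hγ
  A_eq := by simp [init]
  weight_nonneg := by simp [init]
  gap := by simp [init, mid]; ring
  phiSum_nonneg := by simp [init]
  progress := by simp only [init, List.length_nil]; ring_nf; simp
  sq_length_le := by simp [init]
  mid_nonneg := by simp [init, mid]
  mid_le := by simp [init, mid]; positivity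

namespace Reachable

theorem gap_pos [NeZero r] (h : Reachable U γ s) (hγ : 0 < γ) : 0 < s.u - s.l := by
  have hr : (0 : ℝ) < r := by exact_mod_cast NeZero.pos r
  have := h.mid_nonneg
  rw [h.gap]
  positivity

theorem gap_lt (h : Reachable U γ s) (hs : Continues γ s) : s.u - s.l < 8 * r / γ :=
  (le_add_of_nonneg_right h.phiSum_nonneg).trans_lt hs

theorem div_le_inv_gap [NeZero r] (h : Reachable U γ s) (hγ : 0 < γ) (hs : Continues γ s) :
    γ / (2 * r) ≤ 4 / (s.u - s.l) := by
  have hr : (0 : ℝ) < r := by exact_mod_cast NeZero.pos r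
  have h1 := h.gap_lt hs
  have h2 := h.gap_pos hγ
  rw [div_le_div_iff₀ (by positivity) h2]
  rw [lt_div_iff₀ hγ] at h1
  linarith

/-- The loop condition caps the gap, and a capped gap forces a large potential. This bounds the
growth of `mid` per iteration and turns parts of the potential into selection probabilities. -/
theorem half_le_potential [NeZero r] (h : Reachable U γ s) (hγ : 0 < γ) (hs : Continues γ s) :
    γ / 2 ≤ potential s := by
  have hr : (0 : ℝ) < r := by exact_mod_cast NeZero.pos r
  have h1 := mul_le_mul_of_nonneg_right (h.div_le_inv_gap hγ hs) hr.le
  refine le_trans (le_of_eq ?_) (h1.trans (h.balanced.potential_ge (h.gap_pos hγ)))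
  field_simp

theorem update [NeZero r] (h : Reachable U γ s) (hγ : 0 < γ) (hγ4 : γ ≤ 1 / 4)
    (hs : Continues γ s) (x : ι) : Reachable U γ (update U γ s x) := by
  have hr : (1 : ℝ) ≤ r := by exact_mod_cast NeZero.one_le (n := r)
  have hp := h.balanced.potential_pos
  have hm := mid_update (U := U) (s := s) hγ hγ4 x
  have hg := gap_update (U := U) (s := s) hγ hγ4 x
  have hD := le_div_one_sub hγ hγ4
  have hD0 : 0 < γ / (1 - 4 * γ ^ 2) := hγ.trans_le hD
  have hlen : ((Asura.update U γ s x).samples.length : ℝ) = s.samples.length + 1 := by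
    simp [Asura.update]
  have hphi : (Asura.update U γ s x).phiSum = s.phiSum + potential s := rfl
  have hj : (0 : ℝ) ≤ s.samples.length := Nat.cast_nonneg _
  have hS := h.phiSum_nonneg
  have hm0 := h.mid_nonneg
  have hdiv : γ * (1 / potential s) ≤ γ / (1 - 4 * γ ^ 2) * (1 / potential s) :=
    mul_le_mul_of_nonneg_right hD (by positivity)
  have hcancel : potential s * (1 / potential s) = 1 := mul_one_div_cancel hp.ne'
  refine ⟨h.balanced.update hγ hγ4 x, ?_, ?_, ?_, ?_, ?_, ?_, ?_, ?_⟩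
  · change s.A + _ = _
    rw [h.A_eq, add_comm]
    rfl
  · intro q hq
    rcases List.mem_cons.1 hq with rfl | hq
    · exact h.balanced.weight_nonneg hγ.le x
    · exact h.weight_nonneg q hq
  · rw [hg, hm, h.gap]; ring
  · rw [hphi]; linarith
  · rw [hlen, hg, hphi]
    -- AM-GM: `4γ²/Φ + Φ ≥ 4γ`.
    have h1 : 4 * γ ≤ 4 * γ * (γ * (1 / potential s)) + potential s := by
      have : 0 ≤ (2 * γ - potential s) ^ 2 * (1 / potential s) := by positivity
      have h2 : (2 * γ - potential s) ^ 2 * (1 / potential s) =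
          4 * γ * (γ * (1 / potential s)) + potential s - 4 * γ := by
        field_simp
        ring
      linarith
    have h3 := mul_le_mul_of_nonneg_left hdiv (show 0 ≤ 4 * γ by linarith)
    linarith [h.progress]
  · rw [hlen, hphi, hm]
    set t := 1 / potential s
    have ht : 0 < t := by positivity
    -- Inductive step of Cauchy-Schwarz for the sums of `Φ` and `γ/Φ`: AM-GM bounds the cross terms
    -- below by `2γj`.
    have h1 : γ * s.samples.length * 2 ≤ s.phiSum * (γ * t) + potential s * mid s := by
      refine le_of_sq_le_sq ?_ (by positivity)
      have h2 : 4 * (s.phiSum * mid s * γ) * (potential s * t) ≤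
          (s.phiSum * (γ * t) + potential s * mid s) ^ 2 := by
        nlinarith [sq_nonneg (s.phiSum * (γ * t) - potential s * mid s)]
      rw [hcancel] at h2
      nlinarith [mul_le_mul_of_nonneg_right h.sq_length_le hγ.le]
    have h3 := mul_le_mul_of_nonneg_left hdiv (show 0 ≤ s.phiSum + potential s by linarith)
    have h4 : potential s * (γ * t) = γ := by
      rw [mul_left_comm, hcancel, mul_one]
    nlinarith [h.sq_length_le]
  · rw [hm]; positivity
  · rw [hm]
    have h1 : mid s ≤ r / γ ^ 2 := by
      have h2 := h.gap_lt hs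
      rw [h.gap, show 8 * (r : ℝ) / γ = 4 * r / γ + 4 * γ * (r / γ ^ 2) by field_simp; ring] at h2
      nlinarith
    -- The last iteration may overshoot `r/γ²`, but by at most a quarter of it since `Φ ≥ γ/2`.
    have h3 : γ / (1 - 4 * γ ^ 2) * (1 / potential s) ≤ r / (4 * γ ^ 2) := by
      have h5 : 1 / potential s ≤ 2 / γ := by
        rw [div_le_div_iff₀ hp hγ]
        linarith [h.half_le_potential hγ hs]
      refine (mul_le_mul_of_nonneg_left h5 hD0.le).trans ?_
      have h6 : 0 < 1 - 4 * γ ^ 2 := by nlinarith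
      rw [div_mul_div_comm, div_le_div_iff₀ (by positivity) (by positivity)]
      have h7 : γ ^ 2 ≤ 1 / 16 := by nlinarith
      have h8 : 8 * γ ^ 2 ≤ r * (1 - 4 * γ ^ 2) := by nlinarith
      nlinarith
    calc _ ≤ _ := add_le_add h1 h3
      _ = _ := by field_simp; ring

theorem length_lt [NeZero r] (h : Reachable U γ s) (hγ : 0 < γ) (hs : Continues γ s) :
    (s.samples.length : ℝ) < r / γ ^ 2 := by
  have h1 := h.progress.trans_lt hs
  rw [show 8 * (r : ℝ) / γ = 4 * r / γ + 4 * γ * (r / γ ^ 2) by field_simp; ring] at h1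
  nlinarith

end Reachable

/-! ### Expectations over the random run. -/

section Run

variable [Fintype ι]

theorem tsum_bind_mul {α β : Type*} (p : PMF α) (g : α → PMF β) (F : β → ℝ≥0∞) :
    ∑' b, (p.bind g) b * F b = ∑' a, p a * ∑' b, g a b * F b := by
  simp only [PMF.bind_apply, ← ENNReal.tsum_mul_right, ← ENNReal.tsum_mul_left]
  rw [ENNReal.tsum_comm]
  simp only [mul_assoc]

theorem tsum_pure_mul {α : Type*} (a : α) (F : α → ℝ≥0∞) :
    ∑' b, (PMF.pure a) b * F b = F a := by
  rw [tsum_eq_single a]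
  · simp
  · intro b hb; simp [hb]

theorem tsum_map_mul {α β : Type*} (p : PMF α) (g : α → β) (F : β → ℝ≥0∞) :
    ∑' b, (p.map g) b * F b = ∑' a, p a * F (g a) := by
  rw [PMF.map, tsum_bind_mul]
  simp only [Function.comp_apply, tsum_pure_mul]

theorem step_of_continues [NeZero r] (hU : Uᵀ * U = 1) (h : Balanced s) (hs : Continues γ s) :
    ∃ q : PMF ι, (∀ x, q x = ENNReal.ofReal (pointProb U s x)) ∧
      step U γ s = q.map fun x => some (update U γ s x) := by
  have hp : (∀ x, 0 ≤ pointProb U s x) ∧ ∑ x, pointProb U s x = 1 :=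
    ⟨h.pointProb_nonneg, h.sum_pointProb hU⟩
  rw [step, if_pos hs, sampleDist, dif_pos hp, PMF.map_comp]
  exact ⟨_, fun x => rfl, rfl⟩

theorem step_of_not_continues (hs : ¬ Continues γ s) : step U γ s = PMF.pure (some s) := by
  rw [step, if_neg hs]

theorem tsum_step_mul [NeZero r] (hU : Uᵀ * U = 1) (h : Balanced s) (hs : Continues γ s)
    (F : Option (AsuraState ι r) → ℝ≥0∞) :
    ∑' o, step U γ s o * F o =
      ∑ x, ENNReal.ofReal (pointProb U s x) * F (some (update U γ s x)) := by
  obtain ⟨q, hq, hstep⟩ := step_of_continues hU h hs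
  rw [hstep, tsum_map_mul, tsum_fintype]
  simp only [hq]

variable [NeZero r]

/-- Balance makes the sampling numbers a probability vector, so the outcome `none` never occurs. The
last clause dates a running state by its number of samples. -/
theorem reachable_of_mem_support (hU : Uᵀ * U = 1) (hγ : 0 < γ) (hγ4 : γ ≤ 1 / 4) {i : ℕ}
    {o : Option (AsuraState ι r)} (ho : o ∈ (stateAfter U γ i).support) :
    ∃ s, o = some s ∧ Reachable U γ s ∧ s.samples.length ≤ i ∧
      (Continues γ s → s.samples.length = i) := by
  induction i generalizing o with
  | zero =>
    rw [stateAfter, PMF.support_pure, Set.mem_singleton_iff] at ho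
    exact ⟨_, ho, reachable_init hγ, by simp [init], by simp [init]⟩
  | succ i ih =>
    rw [stateAfter, PMF.mem_support_bind_iff] at ho
    obtain ⟨a, ha, ho⟩ := ho
    obtain ⟨s, rfl, hs, hle, heq⟩ := ih ha
    by_cases hc : Continues γ s
    · obtain ⟨q, -, hstep⟩ := step_of_continues hU hs.balanced hc
      simp only [hstep, PMF.mem_support_map_iff] at ho
      obtain ⟨x, -, rfl⟩ := ho
      refine ⟨_, rfl, hs.update hγ hγ4 hc x, ?_, fun _ => ?_⟩ <;> simp [update, heq hc]
    · simp only [step_of_not_continues hc, PMF.support_pure, Set.mem_singleton_iff] at ho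
      exact ⟨s, ho, hs, hle.trans i.le_succ, fun h => absurd h hc⟩

/-- Stopped supermartingale: ended states are kept, so the one-step inequality is needed only while
the loop runs. The horizon `k` allows `f` to contain the number of remaining steps. -/
theorem tsum_stateAfter_mul_le (hU : Uᵀ * U = 1) (hγ : 0 < γ) (hγ4 : γ ≤ 1 / 4)
    {f : AsuraState ι r → ℝ} {k : ℕ}
    (hf : ∀ s, Reachable U γ s → s.samples.length ≤ k → 0 ≤ f s)
    (hstep : ∀ s, Reachable U γ s → Continues γ s → s.samples.length < k →
      ∑ x, pointProb U s x * f (update U γ s x) ≤ f s) {i : ℕ} (hi : i ≤ k) :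
    ∑' o, stateAfter U γ i o * (o.elim 0 fun s => ENNReal.ofReal (f s)) ≤
      ENNReal.ofReal (f (init ι r γ)) := by
  induction i with
  | zero => rw [stateAfter, tsum_pure_mul]; rfl
  | succ i ih =>
    refine le_trans ?_ (ih (Nat.le_of_succ_le hi))
    rw [stateAfter, tsum_bind_mul]
    refine ENNReal.tsum_le_tsum fun o => ?_
    by_cases ho : o ∈ (stateAfter U γ i).support
    · obtain ⟨s, rfl, hs, hle, -⟩ := reachable_of_mem_support hU hγ hγ4 ho
      refine mul_le_mul_right ?_ _
      by_cases hc : Continues γ s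
      · simp only [tsum_step_mul hU hs.balanced hc, Option.elim_some]
        refine le_trans (le_of_eq ?_) (ENNReal.ofReal_le_ofReal (hstep s hs hc (by omega)))
        rw [ENNReal.ofReal_sum_of_nonneg]
        · refine Finset.sum_congr rfl fun x _ => ?_
          rw [ENNReal.ofReal_mul (hs.balanced.pointProb_nonneg x)]
        · intro x _
          refine mul_nonneg (hs.balanced.pointProb_nonneg x) (hf _ (hs.update hγ hγ4 hc x) ?_)
          simp [update]
          omega
      · simp only [step_of_not_continues hc, tsum_pure_mul]
        rfl
    · have : stateAfter U γ i o = 0 := by simpa [PMF.mem_support_iff] using ho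
      simp [this]

/-- Markov's inequality. -/
theorem toOuterMeasure_lt_le {α : Type*} (p : PMF (Option α)) (f : α → ℝ) {a b q : ℝ}
    (ha : 0 ≤ a) (hb : b ≤ q * a)
    (h : ∑' o, p o * (o.elim 0 fun s => ENNReal.ofReal (f s)) ≤ ENNReal.ofReal b) :
    p.toOuterMeasure {o | ∃ s, o = some s ∧ a < f s} ≤ ENNReal.ofReal q := by
  replace h := h.trans (ENNReal.ofReal_le_ofReal hb)
  rw [PMF.toOuterMeasure_apply]
  -- At `a = 0` one cannot divide: the expectation vanishes, so the positive part of `f` is almost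
  -- surely zero.
  rcases ha.eq_or_lt with rfl | ha
  · simp only [mul_zero, ENNReal.ofReal_zero, nonpos_iff_eq_zero, ENNReal.tsum_eq_zero] at h
    refine le_trans (le_of_eq ?_) zero_le
    rw [ENNReal.tsum_eq_zero]
    intro o
    rw [Set.indicator_apply_eq_zero]
    rintro ⟨s, rfl, hs⟩
    simpa [hs.not_ge] using h (some s)
  · have h1 : ENNReal.ofReal a * ∑' o, ({o | ∃ s, o = some s ∧ a < f s} : Set _).indicator p o ≤
        ENNReal.ofReal a * ENNReal.ofReal q := by
      rw [← ENNReal.tsum_mul_left, ← ENNReal.ofReal_mul ha.le, mul_comm a q]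
      refine (ENNReal.tsum_le_tsum fun o => ?_).trans h
      by_cases ho : o ∈ {o | ∃ s, o = some s ∧ a < f s}
      · rw [Set.indicator_of_mem ho]
        obtain ⟨s, rfl, hs⟩ := ho
        rw [mul_comm]
        exact mul_le_mul_right (ENNReal.ofReal_le_ofReal hs.le) _
      · rw [Set.indicator_of_notMem ho]
        simp
    exact (ENNReal.mul_le_mul_iff_right (by simpa using ha) ENNReal.ofReal_ne_top).1 h1

/-- The probability that `mid` is below a given level is nonincreasing in time. -/
theorem toOuterMeasure_mid_lt_antitone (hU : Uᵀ * U = 1) (hγ : 0 < γ) (hγ4 : γ ≤ 1 / 4) (a : ℝ) :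
    Antitone fun i => (stateAfter U γ i).toOuterMeasure {o | ∃ s, o = some s ∧ mid s < a} := by
  refine antitone_nat_of_succ_le fun i => ?_
  change (stateAfter U γ (i + 1)).toOuterMeasure _ ≤ _
  rw [stateAfter, PMF.toOuterMeasure_bind_apply, PMF.toOuterMeasure_apply]
  refine ENNReal.tsum_le_tsum fun o => ?_
  by_cases ho : o ∈ (stateAfter U γ i).support
  · obtain ⟨s, rfl, hs, -, -⟩ := reachable_of_mem_support hU hγ hγ4 ho
    by_cases hm : mid s < a
    · rw [Set.indicator_of_mem (show some s ∈ {o | ∃ s, o = some s ∧ mid s < a} from ⟨s, rfl, hm⟩)]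
      refine mul_le_of_le_one_right' ?_
      rw [PMF.toOuterMeasure_apply, ← (step U γ s).tsum_coe]
      exact ENNReal.tsum_le_tsum fun b => Set.indicator_le_self _ _ _
    · refine le_trans (le_of_eq ?_) zero_le
      convert mul_zero _
      rw [PMF.toOuterMeasure_apply_eq_zero_iff, Set.disjoint_left]
      rintro b hb ⟨t, rfl, ht⟩
      change some t ∈ (step U γ s).support at hb
      by_cases hc : Continues γ s
      · obtain ⟨q, -, hstep⟩ := step_of_continues hU hs.balanced hc
        rw [hstep, PMF.mem_support_map_iff] at hb
        obtain ⟨x, -, hx⟩ := hb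
        obtain rfl := Option.some.inj hx
        rw [mid_update hγ hγ4] at ht
        have := hs.balanced.potential_pos
        have := hγ.trans_le (le_div_one_sub hγ hγ4)
        have : 0 < γ / (1 - 4 * γ ^ 2) * (1 / potential s) := by positivity
        linarith
      · rw [step_of_not_continues hc, PMF.support_pure] at hb
        obtain rfl := Option.some.inj hb
        exact hm ht
  · have : stateAfter U γ i o = 0 := by simpa [PMF.mem_support_iff] using ho
    simp [this]

end Run
end Asura

/-! ### Three tail bounds and their union. -/

namespace Asura

variable {ι : Type*} {r : ℕ} {U : Matrix ι (Fin r) ℝ} {γ : ℝ} {s : AsuraState ι r}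

/-- The unnormalised weighted sum of the sampled rows, scaled by the entries of `e`. -/
noncomputable def sampleSum (U : Matrix ι (Fin r) ℝ) (e : ι → ℝ) (s : AsuraState ι r) :
    Fin r → ℝ :=
  (s.samples.map fun q => (q.2 * e q.1) • U q.1).sum

/-- The part of the potential that belongs to the rows in `T`. -/
noncomputable def partialPotential (U : Matrix ι (Fin r) ℝ) (T : Finset ι) (s : AsuraState ι r) :
    ℝ :=
  ∑ y ∈ T, U y ⬝ᵥ barrier s *ᵥ U y

theorem partialPotential_init [NeZero r] (hγ : 0 < γ) (T : Finset ι) :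
    partialPotential U T (init ι r γ) = γ / r * ∑ y ∈ T, U y ⬝ᵥ U y := by
  have hr : (0 : ℝ) < r := by exact_mod_cast NeZero.pos r
  have h : (((2 * r / γ : ℝ) • (1 : Matrix (Fin r) (Fin r) ℝ)))⁻¹ =
      (γ / (2 * r)) • (1 : Matrix (Fin r) (Fin r) ℝ) := by
    refine inv_eq_left_inv ?_
    rw [smul_mul_smul_comm, Matrix.one_mul, div_mul_div_comm, mul_comm, div_self (by positivity),
      one_smul]
  have hB : barrier (init ι r γ) = (γ / r) • (1 : Matrix (Fin r) (Fin r) ℝ) := by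
    simp only [barrier, init, sub_zero, zero_sub, neg_smul, neg_neg, h, ← add_smul]
    congr 1
    field_simp
    norm_num
  rw [partialPotential, Finset.mul_sum, hB]
  simp [smul_mulVec]

theorem Balanced.partialPotential_nonneg (h : Balanced s) (T : Finset ι) :
    0 ≤ partialPotential U T s :=
  Finset.sum_nonneg fun _ _ => h.posDef_barrier.quad_nonneg _

section Fintype

variable [Fintype ι]

theorem partialPotential_univ (hU : Uᵀ * U = 1) :
    partialPotential U Finset.univ s = potential s :=
  sum_quad_eq_trace hU _

theorem sum_dotProduct_self (hU : Uᵀ * U = 1) : ∑ x, U x ⬝ᵥ U x = r := by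
  simpa using sum_quad_eq_trace hU 1

variable [NeZero r]

theorem Balanced.sum_pointProb_mul_partialPotential_update_le (hU : Uᵀ * U = 1) (h : Balanced s)
    (hγ : 0 < γ) (hγ4 : γ ≤ 1 / 4) (T : Finset ι) :
    ∑ x, pointProb U s x * partialPotential U T (Asura.update U γ s x) ≤
      partialPotential U T s := by
  simp only [partialPotential, Finset.mul_sum]
  rw [Finset.sum_comm]
  exact Finset.sum_le_sum fun y _ => h.sum_pointProb_mul_quad_barrier_update_le hU hγ hγ4 _

/-- One factor `weight` joins the probability to give `γ/Φ`; the other satisfies `weight * |U x|² ≤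
2r` because `B ≥ γ/(2r)` while the loop runs. -/
theorem Reachable.sum_weighted_le (h : Reachable U γ s) (hγ : 0 < γ)
    (hs : Continues γ s) (e : ι → ℝ) :
    ∑ x, pointProb U s x * (weight U γ s x ^ 2 * e x ^ 2 * (U x ⬝ᵥ U x)) ≤
      2 * r * (γ * (1 / potential s)) * ∑ x, e x ^ 2 := by
  have hr : (0 : ℝ) < r := by exact_mod_cast NeZero.pos r
  have hp := h.balanced.potential_pos
  rw [Finset.mul_sum]
  refine Finset.sum_le_sum fun x _ => ?_
  rcases eq_or_ne (U x) 0 with hx | hx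
  · simp only [hx, dotProduct_zero, mul_zero]; positivity
  · have h1 := h.balanced.pointProb_mul_weight (γ := γ) hx
    have h2 := h.balanced.quad_barrier_ge (h.gap_pos hγ) (U x)
    have h0 : 0 ≤ U x ⬝ᵥ U x := by simpa using dotProduct_star_self_nonneg (U x)
    have h3 := (mul_le_mul_of_nonneg_right (h.div_le_inv_gap hγ hs) h0).trans h2
    have hw := h.balanced.weight_nonneg (U := U) hγ.le x
    have h4 := (mul_le_mul_of_nonneg_left h3 hw).trans (h.balanced.weight_mul_quad_le hγ.le x)
    have h5 : weight U γ s x * (U x ⬝ᵥ U x) ≤ 2 * r := by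
      have h6 := mul_le_mul_of_nonneg_left h4 (show 0 ≤ 2 * r / γ by positivity)
      refine (le_of_eq ?_).trans (h6.trans_eq ?_) <;> field_simp
    calc pointProb U s x * (weight U γ s x ^ 2 * e x ^ 2 * (U x ⬝ᵥ U x))
        = pointProb U s x * weight U γ s x * e x ^ 2 * (weight U γ s x * (U x ⬝ᵥ U x)) := by ring
      _ ≤ γ / potential s * e x ^ 2 * (2 * r) := by
        rw [h1]
        exact mul_le_mul_of_nonneg_left h5 (by positivity)
      _ = _ := by ring

theorem Reachable.sum_pointProb_mul_sampleSum_update_le (hU : Uᵀ * U = 1) (h : Reachable U γ s)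
    (hγ : 0 < γ) (hs : Continues γ s) {e : ι → ℝ} (he : Uᵀ *ᵥ e = 0) :
    ∑ x, pointProb U s x *
        (sampleSum U e (Asura.update U γ s x) ⬝ᵥ sampleSum U e (Asura.update U γ s x)) ≤
      sampleSum U e s ⬝ᵥ sampleSum U e s +
        2 * r * (γ * (1 / potential s)) * ∑ x, e x ^ 2 := by
  have h1 : ∀ x, pointProb U s x *
        (sampleSum U e (Asura.update U γ s x) ⬝ᵥ sampleSum U e (Asura.update U γ s x)) =
      (sampleSum U e s ⬝ᵥ sampleSum U e s) * pointProb U s x +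
        2 * (γ / potential s) * ((U x ⬝ᵥ sampleSum U e s) * e x) +
        pointProb U s x * (weight U γ s x ^ 2 * e x ^ 2 * (U x ⬝ᵥ U x)) := by
    intro x
    have h2 : sampleSum U e (Asura.update U γ s x) =
        (weight U γ s x * e x) • U x + sampleSum U e s := rfl
    have h3 : pointProb U s x * weight U γ s x * (U x ⬝ᵥ sampleSum U e s) =
        γ / potential s * (U x ⬝ᵥ sampleSum U e s) := by
      rcases eq_or_ne (U x) 0 with hx | hx
      · simp [hx]
      · rw [h.balanced.pointProb_mul_weight hx]
    rw [h2]
    simp only [add_dotProduct, dotProduct_add, smul_dotProduct, dotProduct_smul, smul_eq_mul]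
    rw [dotProduct_comm (sampleSum U e s) (U x)]
    linear_combination 2 * e x * h3
  -- The cross term has mean zero since `e` is orthogonal to the columns of `U`.
  have h4 : ∑ x, (U x ⬝ᵥ sampleSum U e s) * e x = 0 := by
    have h5 : (U *ᵥ sampleSum U e s) ⬝ᵥ e = 0 := by
      rw [dotProduct_comm, dotProduct_mulVec, ← mulVec_transpose, he, zero_dotProduct]
    exact h5
  simp only [h1]
  rw [Finset.sum_add_distrib, Finset.sum_add_distrib, ← Finset.mul_sum, ← Finset.mul_sum,
    h.balanced.sum_pointProb hU, h4]
  linarith [h.sum_weighted_le hγ hs e]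

theorem toOuterMeasure_phiSum_lt_le (hU : Uᵀ * U = 1) (hγ : 0 < γ) (hγ4 : γ ≤ 1 / 4) (k : ℕ)
    {q a : ℝ} (ha : 0 ≤ a) (hk : k * γ ≤ q * a) :
    (stateAfter U γ k).toOuterMeasure {o | ∃ s, o = some s ∧ a < s.phiSum} ≤
      ENNReal.ofReal q := by
  have h := tsum_stateAfter_mul_le hU hγ hγ4
    -- The sum so far plus the remaining steps at the current potential; its initial value is `kγ`.
    (f := fun s => s.phiSum + ((k : ℝ) - s.samples.length) * partialPotential U Finset.univ s)
    (k := k) ?_ ?_ le_rfl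
  · have hr : (r : ℝ) ≠ 0 := NeZero.ne _
    refine le_trans (PMF.toOuterMeasure_mono _ ?_)
      (toOuterMeasure_lt_le _ _ ha (le_trans (le_of_eq ?_) hk) h)
    · rintro _ ⟨⟨s, rfl, hs⟩, ho⟩
      obtain ⟨_, ⟨⟩, hs', hl, -⟩ := reachable_of_mem_support hU hγ hγ4 ho
      have hl' : (s.samples.length : ℝ) ≤ k := by exact_mod_cast hl
      exact ⟨s, rfl, hs.trans_le (le_add_of_nonneg_right (mul_nonneg (by linarith)
        (hs'.balanced.partialPotential_nonneg _)))⟩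
    · rw [partialPotential_init hγ, sum_dotProduct_self hU]
      simp only [init]
      field_simp
      simp
  · intro s hs hl
    have : (s.samples.length : ℝ) ≤ k := by exact_mod_cast hl
    have := hs.balanced.partialPotential_nonneg (U := U) Finset.univ
    have := hs.phiSum_nonneg
    have : 0 ≤ (k : ℝ) - s.samples.length := by linarith
    positivity
  · intro s hs hc hl
    have hl' : (s.samples.length : ℝ) + 1 ≤ k := by exact_mod_cast hl
    have h1 := hs.balanced.sum_pointProb_mul_partialPotential_update_le hU hγ hγ4 Finset.univ
    rw [partialPotential_univ hU] at *
    have h2 : ∀ x, pointProb U s x * ((update U γ s x).phiSum +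
        ((k : ℝ) - (update U γ s x).samples.length) *
          partialPotential U Finset.univ (update U γ s x)) =
        (s.phiSum + potential s) * pointProb U s x + ((k : ℝ) - (s.samples.length + 1)) *
          (pointProb U s x * partialPotential U Finset.univ (update U γ s x)) := by
      intro x
      simp only [update, List.length_cons, Nat.cast_add, Nat.cast_one]
      ring
    simp only [h2]
    rw [Finset.sum_add_distrib, ← Finset.mul_sum, ← Finset.mul_sum, hs.balanced.sum_pointProb hU]
    nlinarith [mul_le_mul_of_nonneg_left h1 (show 0 ≤ (k : ℝ) - (s.samples.length + 1) by linarith)]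

theorem toOuterMeasure_countP_lt_le (hU : Uᵀ * U = 1) (hγ : 0 < γ) (hγ4 : γ ≤ 1 / 4)
    (P : ι → Bool) (k : ℕ) {q a : ℝ} (ha : 0 ≤ a)
    (hk : k * (2 / r) * ∑ y with P y, U y ⬝ᵥ U y ≤ q * a) :
    (stateAfter U γ k).toOuterMeasure
      {o | ∃ s, o = some s ∧ a < (s.samples.countP fun w => P w.1 : ℕ)} ≤ ENNReal.ofReal q := by
  have h := tsum_stateAfter_mul_le hU hγ hγ4
    -- Each remaining step is charged `2/γ` times the partial potential, which bounds the chance of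
    -- drawing from the class.
    (f := fun s => (s.samples.countP fun w => P w.1 : ℕ) +
      ((k : ℝ) - s.samples.length) * (2 / γ * partialPotential U {y | P y} s))
    (k := k) ?_ ?_ le_rfl
  · refine le_trans (PMF.toOuterMeasure_mono _ ?_)
      (toOuterMeasure_lt_le _ _ ha (le_trans (le_of_eq ?_) hk) h)
    · rintro _ ⟨⟨s, rfl, hs⟩, ho⟩
      obtain ⟨_, ⟨⟩, hs', hl, -⟩ := reachable_of_mem_support hU hγ hγ4 ho
      have hl' : (s.samples.length : ℝ) ≤ k := by exact_mod_cast hl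
      exact ⟨s, rfl, hs.trans_le (le_add_of_nonneg_right (mul_nonneg (by linarith)
        (mul_nonneg (by positivity) (hs'.balanced.partialPotential_nonneg _))))⟩
    · have hr : (r : ℝ) ≠ 0 := NeZero.ne _
      rw [partialPotential_init hγ]
      simp only [init, List.length_nil, List.countP_nil]
      field_simp
      simp
  · intro s hs hl
    have : (s.samples.length : ℝ) ≤ k := by exact_mod_cast hl
    have := hs.balanced.partialPotential_nonneg (U := U) {y | P y}
    have : 0 ≤ (k : ℝ) - s.samples.length := by linarith
    positivity
  · intro s hs hc hl
    have hl' : (s.samples.length : ℝ) + 1 ≤ k := by exact_mod_cast hl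
    have hp := hs.balanced.potential_pos
    have hT := hs.balanced.partialPotential_nonneg (U := U) {y | P y}
    have h1 := hs.balanced.sum_pointProb_mul_partialPotential_update_le hU hγ hγ4 {y | P y}
    have h2 : ∀ x, pointProb U s x * (((update U γ s x).samples.countP fun w => P w.1 : ℕ) +
        ((k : ℝ) - (update U γ s x).samples.length) *
          (2 / γ * partialPotential U {y | P y} (update U γ s x))) =
        (s.samples.countP fun w => P w.1 : ℕ) * pointProb U s x +
          (if P x then pointProb U s x else 0) +
        ((k : ℝ) - (s.samples.length + 1)) * (2 / γ) *
          (pointProb U s x * partialPotential U {y | P y} (update U γ s x)) := by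
      intro x
      simp only [update, List.length_cons, Nat.cast_add, Nat.cast_one, List.countP_cons]
      split_ifs <;> push_cast <;> ring
    have h3 : ∑ x, (if P x then pointProb U s x else 0) ≤
        2 / γ * partialPotential U {y | P y} s := by
      have h4 : ∑ x, (if P x then pointProb U s x else 0) =
          1 / potential s * partialPotential U {y | P y} s := by
        rw [← Finset.sum_filter, partialPotential, Finset.mul_sum]
        exact Finset.sum_congr rfl fun x _ => by rw [pointProb]; ring
      rw [h4]
      refine mul_le_mul_of_nonneg_right ?_ hT
      rw [div_le_div_iff₀ hp hγ]
      linarith [hs.half_le_potential hγ hc]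
    simp only [h2]
    rw [Finset.sum_add_distrib, Finset.sum_add_distrib, ← Finset.mul_sum, ← Finset.mul_sum,
      hs.balanced.sum_pointProb hU]
    have h5 : 0 ≤ ((k : ℝ) - (s.samples.length + 1)) * (2 / γ) :=
      mul_nonneg (by linarith) (by positivity)
    linarith [mul_le_mul_of_nonneg_left h1 h5]

theorem toOuterMeasure_sampleSum_lt_le (hU : Uᵀ * U = 1) (hγ : 0 < γ) (hγ4 : γ ≤ 1 / 4)
    {e : ι → ℝ} (he : Uᵀ *ᵥ e = 0) (k : ℕ) {q a : ℝ} (ha : 0 ≤ a)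
    (hk : 2 * r * (∑ x, e x ^ 2) * (5 * r / (4 * γ ^ 2)) ≤ q * a) :
    (stateAfter U γ k).toOuterMeasure
      {o | ∃ s, o = some s ∧ a < sampleSum U e s ⬝ᵥ sampleSum U e s} ≤ ENNReal.ofReal q := by
  have hE : 0 ≤ ∑ x, e x ^ 2 := Finset.sum_nonneg fun _ _ => sq_nonneg _
  have h := tsum_stateAfter_mul_le hU hγ hγ4
    -- Growth of the second moment is paid for by growth of `mid`; the ceiling `mid_le` keeps the
    -- compensator nonnegative.
    (f := fun s => sampleSum U e s ⬝ᵥ sampleSum U e s +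
      2 * r * (∑ x, e x ^ 2) * (5 * r / (4 * γ ^ 2) - mid s)) (k := k) ?_ ?_ le_rfl
  · refine le_trans (PMF.toOuterMeasure_mono _ ?_)
      (toOuterMeasure_lt_le _ _ ha (le_trans (le_of_eq ?_) hk) h)
    · rintro _ ⟨⟨s, rfl, hs⟩, ho⟩
      obtain ⟨_, ⟨⟩, hs', hl, -⟩ := reachable_of_mem_support hU hγ hγ4 ho
      exact ⟨s, rfl, hs.trans_le (le_add_of_nonneg_right (mul_nonneg (by positivity)
        (sub_nonneg.2 hs'.mid_le)))⟩
    · simp [init, sampleSum, mid]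
  · intro s hs _
    have h1 := sub_nonneg.2 hs.mid_le
    have h2 : 0 ≤ sampleSum U e s ⬝ᵥ sampleSum U e s := by
      simpa using dotProduct_star_self_nonneg (sampleSum U e s)
    positivity
  · intro s hs hc _
    have h1 := hs.sum_pointProb_mul_sampleSum_update_le hU hγ hc he
    have hp := hs.balanced.potential_pos
    have hD : γ * (1 / potential s) ≤ γ / (1 - 4 * γ ^ 2) * (1 / potential s) :=
      mul_le_mul_of_nonneg_right (le_div_one_sub hγ hγ4) (by positivity)
    simp only [mul_add (pointProb U s _), mid_update hγ hγ4]
    rw [Finset.sum_add_distrib, ← Finset.sum_mul, hs.balanced.sum_pointProb hU]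
    have h2 := mul_le_mul_of_nonneg_left hD (show 0 ≤ 2 * r * ∑ x, e x ^ 2 by positivity)
    linarith

/-- Stop the clock at time `k ≈ q r/γ²`, when the sum of potentials is below `2r/γ` except with
probability `q`. If the loop still runs, Cauchy-Schwarz gives `mid ≥ (q²/2) r/γ²`. If it has ended,
its condition and the gap formula give `mid > r/(2γ²)`. Later times are covered because `mid` never
decreases. -/
theorem toOuterMeasure_mid_lt_le (hU : Uᵀ * U = 1) (hγ : 0 < γ) (hγ4 : γ ≤ 1 / 4) {q : ℝ}
    (hq : 0 < q) (hq1 : q ≤ 1) (hqr : 1 ≤ q * (r / γ ^ 2)) {K : ℕ} (hK : r / γ ^ 2 ≤ K) :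
    (stateAfter U γ K).toOuterMeasure
      {o | ∃ s, o = some s ∧ mid s < q ^ 2 / 4 * (r / γ ^ 2)} ≤ ENNReal.ofReal q := by
  have hr : (0 : ℝ) < r := by exact_mod_cast NeZero.pos r
  set k := ⌈q * (r / γ ^ 2)⌉₊ with hk
  have hk1 : q * (r / γ ^ 2) ≤ k := Nat.le_ceil _
  have hk2 : (k : ℝ) < 2 * (q * (r / γ ^ 2)) :=
    (Nat.ceil_lt_add_one (by positivity)).trans_le (by linarith)
  have hkK : k ≤ K := by
    refine Nat.ceil_le.2 (le_trans ?_ hK)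
    exact mul_le_of_le_one_left (by positivity) hq1
  refine (toOuterMeasure_mid_lt_antitone hU hγ hγ4 _ hkK).trans
    (le_trans (PMF.toOuterMeasure_mono _ ?_) (toOuterMeasure_phiSum_lt_le hU hγ hγ4 k
      (q := q) (a := k * γ / q) (by positivity) (by field_simp; rfl)))
  rintro _ ⟨⟨s, rfl, hs⟩, ho⟩
  obtain ⟨_, ⟨⟩, hs', -, hl⟩ := reachable_of_mem_support hU hγ hγ4 ho
  refine ⟨s, rfl, ?_⟩
  by_contra! hS
  replace hS : s.phiSum < 2 * r / γ := by
    refine hS.trans_lt ?_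
    have := mul_lt_mul_of_pos_right hk2 (div_pos hγ hq)
    refine (le_of_eq ?_).trans_lt (this.trans_eq ?_) <;> field_simp
  have hX : 0 < r / γ ^ 2 := by positivity
  by_cases hc : Continues γ s
  · have h1 := hs'.sq_length_le
    rw [hl hc] at h1
    have h2 := mul_le_mul_of_nonneg_right hS.le hs'.mid_nonneg
    have h3 : (q * (r / γ ^ 2)) ^ 2 ≤ (k : ℝ) ^ 2 := pow_le_pow_left₀ (by positivity) hk1 2
    have h4 := mul_le_mul_of_nonneg_left h3 hγ.le
    have h5 : γ * (q * (r / γ ^ 2)) ^ 2 = 2 * r / γ * (q ^ 2 / 2 * (r / γ ^ 2)) := by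
      field_simp
    have h6 := h5.symm.trans_le (h4.trans (h1.trans h2))
    have h7 := le_of_mul_le_mul_left h6 (by positivity)
    have : 0 < q ^ 2 * (r / γ ^ 2) := by positivity
    linarith
  · have h1 := not_lt.1 hc
    rw [hs'.gap] at h1
    have h2 : 4 * γ * (1 / 2 * (r / γ ^ 2)) = 2 * r / γ := by field_simp; norm_num
    have h3 : 8 * r / γ = 4 * r / γ + 2 * r / γ + 2 * (r : ℝ) / γ := by ring
    have h4 : 4 * γ * (1 / 2 * (r / γ ^ 2)) < 4 * γ * mid s := by linarith
    have h5 := lt_of_mul_lt_mul_left h4 (by positivity)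
    have h6 : q ^ 2 ≤ 1 := by nlinarith
    nlinarith

/-- With probability at least `p`, the sampler ends with a large `mid`, few samples from the given
class of rows, and a small weighted sum of rows in the direction of an orthogonal vector. -/
theorem ofReal_le_outputProb (hU : Uᵀ * U = 1) (hγ : 0 < γ) (hγ4 : γ ≤ 1 / 4) {p q : ℝ}
    (hq : 0 < q) (hq1 : q ≤ 1) (hpq : p + 3 * q ≤ 1) (hqr : 1 ≤ q * (r / γ ^ 2)) (T : ι → Bool)
    {e : ι → ℝ} (he : Uᵀ *ᵥ e = 0) {P : AsuraState ι r → Prop}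
    (hP : ∀ s, Reachable U γ s → ¬ Continues γ s → q ^ 2 / 4 * (r / γ ^ 2) ≤ mid s →
      s.samples.length ≤ 2 * (r / γ ^ 2) →
      (s.samples.countP fun w => T w.1 : ℕ) ≤ 4 / (q * γ ^ 2) * ∑ y with T y, U y ⬝ᵥ U y →
      sampleSum U e s ⬝ᵥ sampleSum U e s ≤ 5 * r ^ 2 / (2 * q * γ ^ 2) * ∑ x, e x ^ 2 → P s) :
    ENNReal.ofReal p ≤ outputProb U γ P := by
  have hr : (0 : ℝ) < r := by exact_mod_cast NeZero.pos r
  have hX : 0 < r / γ ^ 2 := by positivity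
  have hE : 0 ≤ ∑ x, e x ^ 2 := Finset.sum_nonneg fun _ _ => sq_nonneg _
  have hR : 0 ≤ ∑ y with T y, U y ⬝ᵥ U y :=
    Finset.sum_nonneg fun y _ => by simpa using dotProduct_star_self_nonneg (U y)
  -- By time `K` the loop has ended with certainty, by `length_lt`.
  set K := ⌈r / γ ^ 2⌉₊ with hKdef
  have hK1 : r / γ ^ 2 ≤ K := Nat.le_ceil _
  have hK2 : (K : ℝ) ≤ 2 * (r / γ ^ 2) := by
    have := Nat.ceil_lt_add_one hX.le
    nlinarith
  have b1 := toOuterMeasure_mid_lt_le hU hγ hγ4 hq hq1 hqr hK1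
  have b2 := toOuterMeasure_countP_lt_le hU hγ hγ4 T K (q := q)
    (a := 4 / (q * γ ^ 2) * ∑ y with T y, U y ⬝ᵥ U y) (by positivity) (by
      rw [← mul_assoc]
      refine mul_le_mul_of_nonneg_right ?_ hR
      refine (mul_le_mul_of_nonneg_right hK2 (by positivity)).trans_eq ?_
      field_simp
      norm_num)
  have b3 := toOuterMeasure_sampleSum_lt_le hU hγ hγ4 he K (q := q)
    (a := 5 * r ^ 2 / (2 * q * γ ^ 2) * ∑ x, e x ^ 2) (by positivity) (le_of_eq (by
      field_simp
      ring))
  refine le_trans ?_ (le_iSup _ K)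
  set μ := (stateAfter U γ K).toOuterMeasure
  have h1 : 1 ≤ μ ({o | ∃ s, o = some s ∧ ¬Continues γ s ∧ P s} ∪
      ({o | ∃ s, o = some s ∧ mid s < q ^ 2 / 4 * (r / γ ^ 2)} ∪
      ({o | ∃ s, o = some s ∧ 4 / (q * γ ^ 2) * ∑ y with T y, U y ⬝ᵥ U y <
        (s.samples.countP fun w => T w.1 : ℕ)} ∪
      {o | ∃ s, o = some s ∧ 5 * r ^ 2 / (2 * q * γ ^ 2) * ∑ x, e x ^ 2 <
        sampleSum U e s ⬝ᵥ sampleSum U e s}))) := by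
    rw [← (PMF.toOuterMeasure_apply_eq_one_iff (p := stateAfter U γ K) (s := Set.univ)).2
      (Set.subset_univ _)]
    refine PMF.toOuterMeasure_mono _ ?_
    rintro o ⟨-, ho⟩
    obtain ⟨s, rfl, hs, hlen, hl⟩ := reachable_of_mem_support hU hγ hγ4 ho
    by_contra hcon
    simp only [Set.mem_union, not_or] at hcon
    obtain ⟨c1, c2, c3, c4⟩ := hcon
    have hc : ¬ Continues γ s := fun hc => by
      have := hs.length_lt hγ hc
      rw [hl hc] at this
      linarith
    refine c1 ⟨s, rfl, hc, hP s hs hc ?_ ?_ ?_ ?_⟩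
    · by_contra! h; exact c2 ⟨s, rfl, h⟩
    · exact le_trans (by exact_mod_cast hlen) hK2
    · by_contra! h; exact c3 ⟨s, rfl, h⟩
    · by_contra! h; exact c4 ⟨s, rfl, h⟩
  have h2 := h1.trans ((MeasureTheory.measure_union_le _ _).trans (add_le_add_right
    ((MeasureTheory.measure_union_le _ _).trans (add_le_add b1
      ((MeasureTheory.measure_union_le _ _).trans (add_le_add b2 b3)))) _))
  rw [← ENNReal.ofReal_add hq.le hq.le, ← ENNReal.ofReal_add hq.le (by linarith)] at h2
  have h3 : ENNReal.ofReal p ≤ 1 - ENNReal.ofReal (q + (q + q)) := by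
    rw [← ENNReal.ofReal_one, ← ENNReal.ofReal_sub _ (by linarith)]
    exact ENNReal.ofReal_le_ofReal (by linarith)
  exact h3.trans (tsub_le_iff_right.2 h2)

end Fintype
end Asura

/-! ### The sampled loss as a weighted norm and as a quadratic polynomial. -/

theorem sqNorm_eq_dotProduct {ι : Type*} [Fintype ι] (v : ι → ℝ) : sqNorm v = v ⬝ᵥ v := by
  simp [sqNorm, dotProduct, sq]

theorem sqNorm_nonneg {ι : Type*} [Fintype ι] (v : ι → ℝ) : 0 ≤ sqNorm v :=
  Finset.sum_nonneg fun _ _ => sq_nonneg _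

theorem sum_sum_ite_mul_sq {ι : Type*} [Fintype ι] [DecidableEq ι] (out : List (ι × ℝ))
    (z : ι → ℝ) :
    ∑ x, (out.map fun q => if q.1 = x then q.2 else 0).sum * z x ^ 2 =
      (out.map fun q => q.2 * z q.1 ^ 2).sum := by
  induction out with
  | nil => simp
  | cons a out ih => simp [add_mul, Finset.sum_add_distrib, ih]

theorem sampledLoss_eq_sqNorm {ι : Type*} [Fintype ι] {d : ℕ} (X : Matrix ι (Fin d) ℝ)
    (Y : ι → ℝ) {out : List (ι × ℝ)} (hout : ∀ q ∈ out, 0 ≤ q.2) (β : Fin d → ℝ) :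
    sampledLoss X Y out β = sqNorm (weightMatrix out *ᵥ (X *ᵥ β - Y)) := by
  classical
  have h0 : ∀ x, 0 ≤ (out.map fun q => if q.1 = x then q.2 else 0).sum := by
    intro x
    refine List.sum_nonneg fun y hy => ?_
    obtain ⟨q, hq, rfl⟩ := List.mem_map.1 hy
    split_ifs
    exacts [hout q hq, le_rfl]
  rw [sampledLoss, sqNorm, ← sum_sum_ite_mul_sq out fun x => X x ⬝ᵥ β - Y x]
  refine Finset.sum_congr rfl fun x _ => ?_
  rw [weightMatrix, mulVec_diagonal, mul_pow, Real.sq_sqrt]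
  · congr! 5
  · convert h0 x

theorem ncard_weightSupport_le {ι : Type*} [Finite ι] (out : List (ι × ℝ)) :
    (weightSupport out).ncard ≤ out.length := by
  classical
  have h : weightSupport out ⊆ ((out.map Prod.fst).toFinset : Set ι) := by
    intro x hx
    by_contra hcon
    simp only [List.coe_toFinset, List.mem_map, Set.mem_ofPred_eq, not_exists, not_and] at hcon
    refine hx ?_
    rw [weightMatrix, diagonal_apply_eq, Real.sqrt_eq_zero']
    refine le_of_eq (List.sum_eq_zero fun y hy => ?_)
    obtain ⟨q, hq, rfl⟩ := List.mem_map.1 hy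
    exact if_neg (hcon q hq)
  refine (Set.ncard_le_ncard h (Finset.finite_toSet _)).trans ?_
  rw [Set.ncard_coe_finset]
  exact (List.toFinset_card_le _).trans (by simp)

namespace Matrix

variable {ι : Type*} {r : ℕ}

/-- The weighted Gram matrix of the sampled rows. -/
def sampledGram (U : Matrix ι (Fin r) ℝ) (out : List (ι × ℝ)) : Matrix (Fin r) (Fin r) ℝ :=
  (out.map fun q => q.2 • vecMulVec (U q.1) (U q.1)).sum

/-- The weighted sum of the sampled rows, scaled by the entries of `e`. -/
def sampledCorrelation (U : Matrix ι (Fin r) ℝ) (e : ι → ℝ) (out : List (ι × ℝ)) : Fin r → ℝ :=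
  (out.map fun q => (q.2 * e q.1) • U q.1).sum

variable {U : Matrix ι (Fin r) ℝ} {out : List (ι × ℝ)}

theorem isHermitian_sampledGram : (sampledGram U out).IsHermitian := by
  induction out with
  | nil => simp [sampledGram]
  | cons a out ih =>
    refine IsHermitian.add ?_ ih
    ext i j
    simp [vecMulVec, mul_comm (U a.1 i)]

theorem posDef_sampledGram
    (hG : ∀ δ, 1 / 2 * (δ ⬝ᵥ δ) ≤ δ ⬝ᵥ sampledGram U out *ᵥ δ) : (sampledGram U out).PosDef := by
  refine posDef_of_real isHermitian_sampledGram fun x hx => lt_of_lt_of_le ?_ (hG x)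
  have : 0 < x ⬝ᵥ x := by simpa using dotProduct_star_self_pos_iff.2 hx
  positivity

/-- The second order expansion of the sampled loss. -/
theorem sum_sq_add_sub (Y : ι → ℝ) (α δ : Fin r → ℝ) :
    (out.map fun q => q.2 * (U q.1 ⬝ᵥ (α + δ) - Y q.1) ^ 2).sum =
      (out.map fun q => q.2 * (U q.1 ⬝ᵥ α - Y q.1) ^ 2).sum -
        2 * (sampledCorrelation U (Y - U *ᵥ α) out ⬝ᵥ δ) + δ ⬝ᵥ sampledGram U out *ᵥ δ := by
  induction out with
  | nil => simp [sampledCorrelation, sampledGram]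
  | cons a out ih =>
    rw [List.map_cons, List.sum_cons, ih]
    have h1 : sampledCorrelation U (Y - U *ᵥ α) (a :: out) =
        (a.2 * (Y a.1 - U a.1 ⬝ᵥ α)) • U a.1 + sampledCorrelation U (Y - U *ᵥ α) out := rfl
    have h2 : sampledGram U (a :: out) = a.2 • vecMulVec (U a.1) (U a.1) + sampledGram U out := rfl
    rw [h1, h2, List.map_cons, List.sum_cons, add_mulVec, smul_mulVec, vecMulVec_mulVec]
    simp only [add_dotProduct, dotProduct_add, smul_dotProduct, dotProduct_smul, smul_eq_mul,
      op_smul_eq_smul, dotProduct_comm δ (U a.1)]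
    ring

end Matrix

/-! ### Least squares in orthonormal coordinates. -/

section SVD

variable {ι : Type*} [Fintype ι] {d r : ℕ} {X : Matrix ι (Fin d) ℝ} {U : Matrix ι (Fin r) ℝ}
  {σ : Fin r → ℝ} {V : Matrix (Fin d) (Fin r) ℝ}

namespace IsCompactSVD

theorem factor' (h : IsCompactSVD X U σ V) : X = U * (diagonal σ * Vᵀ) := by
  rw [← Matrix.mul_assoc]; exact h.factor

theorem surjective (h : IsCompactSVD X U σ V) (α : Fin r → ℝ) :
    ∃ β, (diagonal σ * Vᵀ) *ᵥ β = α := by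
  refine ⟨(V * diagonal fun k => (σ k)⁻¹) *ᵥ α, ?_⟩
  rw [mulVec_mulVec, Matrix.mul_assoc, ← Matrix.mul_assoc Vᵀ, h.orthonormal_right, Matrix.one_mul,
    diagonal_mul_diagonal]
  have : (fun i => σ i * (σ i)⁻¹) = fun _ => 1 := by
    ext i; exact mul_inv_cancel₀ (h.pos i).ne'
  rw [this, diagonal_one, one_mulVec]

theorem le_dim (h : IsCompactSVD X U σ V) : r ≤ d := by
  have h1 := rank_mul_le_left Vᵀ V
  rw [h.orthonormal_right, rank_one, rank_transpose, Fintype.card_fin] at h1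
  exact h1.trans (rank_le_height V)

theorem mulVec_eq (h : IsCompactSVD X U σ V) (β : Fin d → ℝ) :
    X *ᵥ β = U *ᵥ ((diagonal σ * Vᵀ) *ᵥ β) := by
  rw [mulVec_mulVec, ← h.factor']

theorem transpose_mulVec_residual (h : IsCompactSVD X U σ V) (Y : ι → ℝ) :
    Uᵀ *ᵥ (Y - U *ᵥ (Uᵀ *ᵥ Y)) = 0 := by
  rw [mulVec_sub, mulVec_mulVec, h.orthonormal_left, one_mulVec, sub_self]

theorem sqNorm_sub (h : IsCompactSVD X U σ V) (Y : ι → ℝ) (δ : Fin r → ℝ) :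
    sqNorm (U *ᵥ (Uᵀ *ᵥ Y + δ) - Y) = δ ⬝ᵥ δ + sqNorm (Y - U *ᵥ (Uᵀ *ᵥ Y)) := by
  have h1 : U *ᵥ (Uᵀ *ᵥ Y + δ) - Y = U *ᵥ δ - (Y - U *ᵥ (Uᵀ *ᵥ Y)) := by
    rw [mulVec_add]; abel
  have h2 : (Y - U *ᵥ (Uᵀ *ᵥ Y)) ⬝ᵥ U *ᵥ δ = 0 := by
    rw [dotProduct_mulVec, ← mulVec_transpose, h.transpose_mulVec_residual, zero_dotProduct]
  have h3 : (U *ᵥ δ) ⬝ᵥ (U *ᵥ δ) = δ ⬝ᵥ δ := Asura.sum_dotProduct_mul h.orthonormal_left δ δ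
  rw [h1, sqNorm_eq_dotProduct, sqNorm_eq_dotProduct]
  generalize Y - U *ᵥ (Uᵀ *ᵥ Y) = e at *
  rw [sub_dotProduct, dotProduct_sub, dotProduct_sub, h3, dotProduct_comm (U *ᵥ δ), h2]
  ring

end IsCompactSVD
end SVD

/-- All the regression content, with no randomness. A minimiser does at least as well as `δ = 0`, so
`|δ|²/2 ≤ δᵀGδ ≤ 2 g·δ`, and Cauchy-Schwarz gives `|δ|² ≤ 16 |g|² ≤ 16 c |e|²`. Existence comes from
`δ = G⁻¹ g`. -/
theorem isGoodOutput_of_sampledGram {n₁ n₂ d r : ℕ} {X : Matrix (Fin n₁ ⊕ Fin n₂) (Fin d) ℝ}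
    {Y : Fin n₁ ⊕ Fin n₂ → ℝ} {U : Matrix (Fin n₁ ⊕ Fin n₂) (Fin r) ℝ} {σ : Fin r → ℝ}
    {V : Matrix (Fin d) (Fin r) ℝ} (h : IsCompactSVD X U σ V) {R C ε c : ℝ}
    {out : List ((Fin n₁ ⊕ Fin n₂) × ℝ)} (hout : ∀ q ∈ out, 0 ≤ q.2)
    (hG : ∀ δ, 1 / 2 * (δ ⬝ᵥ δ) ≤ δ ⬝ᵥ sampledGram U out *ᵥ δ)
    (hg : sampledCorrelation U (Y - U *ᵥ (Uᵀ *ᵥ Y)) out ⬝ᵥ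
      sampledCorrelation U (Y - U *ᵥ (Uᵀ *ᵥ Y)) out ≤ c * sqNorm (Y - U *ᵥ (Uᵀ *ᵥ Y)))
    (hc : 16 * c ≤ C * ε) (hC : 0 ≤ C * ε) (hq : (labelQueries out : ℝ) ≤ C * (R / ε))
    (hs : (out.length : ℝ) ≤ C * (d / ε)) :
    IsGoodOutput X Y (fun β => sqNorm (X *ᵥ β - Y)) R C ε out := by
  have hloss := sampledLoss_eq_sqNorm X Y hout
  set g := sampledCorrelation U (Y - U *ᵥ (Uᵀ *ᵥ Y)) out
  have hexp : ∀ β δ, (diagonal σ * Vᵀ) *ᵥ β = Uᵀ *ᵥ Y + δ →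
      sqNorm (weightMatrix out *ᵥ (X *ᵥ β - Y)) =
        (out.map fun q => q.2 * (U q.1 ⬝ᵥ (Uᵀ *ᵥ Y) - Y q.1) ^ 2).sum - 2 * (g ⬝ᵥ δ) +
          δ ⬝ᵥ sampledGram U out *ᵥ δ := by
    intro β δ hβ
    rw [← hloss, ← sum_sq_add_sub, ← hβ, sampledLoss]
    have : ∀ x, X x ⬝ᵥ β = U x ⬝ᵥ ((diagonal σ * Vᵀ) *ᵥ β) := fun x =>
      congr_fun (h.mulVec_eq β) x
    simp only [this]
  have hδ : ∀ β, (diagonal σ * Vᵀ) *ᵥ β =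
      Uᵀ *ᵥ Y + ((diagonal σ * Vᵀ) *ᵥ β - Uᵀ *ᵥ Y) := fun β => by abel
  refine ⟨hq, le_trans (by exact_mod_cast ncard_weightSupport_le out) hs, hloss, ?_, ?_⟩
  · have hpos := posDef_sampledGram hG
    obtain ⟨βhat, hβ⟩ := h.surjective (Uᵀ *ᵥ Y + (sampledGram U out)⁻¹ *ᵥ g)
    refine ⟨βhat, fun β => ?_⟩
    rw [hexp _ _ hβ, hexp _ _ (hδ β), hpos.mulVec_inv_mulVec, dotProduct_comm _ g]
    linarith [hpos.two_mul_dotProduct_sub_le g ((diagonal σ * Vᵀ) *ᵥ β - Uᵀ *ᵥ Y)]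
  · intro βhat hmin β
    -- `β₀` is an exact minimiser of the full loss, used as competitor.
    obtain ⟨β₀, hβ₀⟩ := h.surjective (Uᵀ *ᵥ Y + 0)
    have h1 := hmin β₀
    obtain ⟨δ, hd⟩ : ∃ δ, (diagonal σ * Vᵀ) *ᵥ βhat = Uᵀ *ᵥ Y + δ := ⟨_, hδ βhat⟩
    rw [hexp _ _ hd, hexp _ _ hβ₀] at h1
    simp only [dotProduct_zero, mulVec_zero] at h1
    have h2 := hG δ
    have h3 : (g ⬝ᵥ δ) ^ 2 ≤ (g ⬝ᵥ g) * (δ ⬝ᵥ δ) := by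
      simpa using (PosDef.one (n := Fin r) (R := ℝ)).dotProduct_sq_le g δ
    have h0 : 0 ≤ δ ⬝ᵥ δ := by simpa using dotProduct_star_self_nonneg δ
    have hg0 : 0 ≤ g ⬝ᵥ g := by simpa using dotProduct_star_self_nonneg g
    have h4 : δ ⬝ᵥ δ ≤ 16 * (g ⬝ᵥ g) := by
      rcases h0.eq_or_lt with h5 | h5
      · linarith
      · refine le_of_mul_le_mul_right ?_ h5
        nlinarith
    have h6 : ∀ β, sqNorm (Y - U *ᵥ (Uᵀ *ᵥ Y)) ≤ sqNorm (X *ᵥ β - Y) := fun β => by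
      rw [h.mulVec_eq, hδ β, h.sqNorm_sub]
      have := dotProduct_star_self_nonneg ((diagonal σ * Vᵀ) *ᵥ β - Uᵀ *ᵥ Y)
      simp only [star_trivial] at this
      linarith
    change sqNorm (X *ᵥ βhat - Y) ≤ (1 + C * ε) * sqNorm (X *ᵥ β - Y)
    have h7 : sqNorm (X *ᵥ βhat - Y) = δ ⬝ᵥ δ + sqNorm (Y - U *ᵥ (Uᵀ *ᵥ Y)) := by
      rw [h.mulVec_eq, hd, h.sqNorm_sub]
    rw [h7]
    have h8 := mul_le_mul_of_nonneg_left (h6 β) (show 0 ≤ 1 + C * ε by linarith)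
    have h9 := mul_le_mul_of_nonneg_right hc (sqNorm_nonneg (Y - U *ᵥ (Uᵀ *ᵥ Y)))
    linarith

/-! ### Total leverage of `X₁` and its three closed forms. -/

namespace IsCompactSVD

variable {n₁ n₂ d r : ℕ} {X₁ : Matrix (Fin n₁) (Fin d) ℝ} {X₂ : Matrix (Fin n₂) (Fin d) ℝ}
  {U : Matrix (Fin n₁ ⊕ Fin n₂) (Fin r) ℝ} {σ : Fin r → ℝ} {V : Matrix (Fin d) (Fin r) ℝ}

/-- The total leverage of the rows of `X₁` is the trace of `D X₁ᵀ X₁` for every generalised inverse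
`D` of `Xᵀ X`. -/
theorem sum_leverage_eq_trace (h : IsCompactSVD (fromRows X₁ X₂) U σ V)
    {D : Matrix (Fin d) (Fin d) ℝ}
    (hD : (fromRows X₁ X₂)ᵀ * fromRows X₁ X₂ * D * ((fromRows X₁ X₂)ᵀ * fromRows X₁ X₂) =
      (fromRows X₁ X₂)ᵀ * fromRows X₁ X₂) :
    ∑ y with Sum.isLeft y, U y ⬝ᵥ U y = (D * (X₁ᵀ * X₁)).trace := by
  set W := diagonal σ * Vᵀ with hW
  set U₁ : Matrix (Fin n₁) (Fin r) ℝ := U.submatrix Sum.inl id with hU₁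
  have hX₁ : X₁ = U₁ * W := by
    ext i j
    simpa [mul_apply, hU₁, ← hW] using congr_fun (congr_fun h.factor' (Sum.inl i)) j
  have hXX : (fromRows X₁ X₂)ᵀ * fromRows X₁ X₂ = Wᵀ * W := by
    rw [h.factor', transpose_mul, Matrix.mul_assoc, ← Matrix.mul_assoc Uᵀ, h.orthonormal_left,
      Matrix.one_mul]
  have hWW : W * Wᵀ = diagonal fun k => σ k * σ k := by
    rw [hW, transpose_mul, transpose_transpose, diagonal_transpose, Matrix.mul_assoc,
      ← Matrix.mul_assoc Vᵀ, h.orthonormal_right, Matrix.one_mul, diagonal_mul_diagonal]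
  have hunit : IsUnit (W * Wᵀ) := by
    rw [hWW, isUnit_iff_isUnit_det, det_diagonal, isUnit_iff_ne_zero, Finset.prod_ne_zero_iff]
    exact fun k _ => (mul_pos (h.pos k) (h.pos k)).ne'
  have hone : W * D * Wᵀ = 1 := by
    rw [hXX] at hD
    refine hunit.mul_left_cancel (hunit.mul_right_cancel ?_)
    rw [Matrix.mul_one]
    have := congrArg (fun M => W * M * Wᵀ) hD
    simpa only [Matrix.mul_assoc] using this
  have hleft : ∑ y with Sum.isLeft y, U y ⬝ᵥ U y = (U₁ * U₁ᵀ).trace := by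
    rw [Finset.sum_filter, Fintype.sum_sum_type]
    simp [trace, mul_apply, dotProduct, hU₁]
  have hright : (D * (X₁ᵀ * X₁)).trace = (W * D * Wᵀ * (U₁ᵀ * U₁)).trace := by
    rw [hX₁, transpose_mul, ← Matrix.mul_assoc, ← Matrix.mul_assoc, trace_mul_comm]
    simp only [Matrix.mul_assoc]
  rw [hleft, hright, hone, Matrix.one_mul, trace_mul_comm]

theorem sum_leverage_eq_reducedRank (h : IsCompactSVD (fromRows X₁ X₂) U σ V)
    (hX : IsUnit ((fromRows X₁ X₂)ᵀ * fromRows X₁ X₂).det) :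
    ∑ y with Sum.isLeft y, U y ⬝ᵥ U y = reducedRank X₁ X₂ :=
  h.sum_leverage_eq_trace (by rw [mul_nonsing_inv _ hX, Matrix.one_mul])

/-- With `0⁻¹ = 0`, inverting the eigenvalues gives the pseudo-inverse of `XᵀX`, so `X` may be rank
deficient and zero eigenvalues contribute nothing. -/
theorem sum_leverage_of_diagonal (h : IsCompactSVD (fromRows X₁ X₂) U σ V)
    {Q : Matrix (Fin d) (Fin d) ℝ} (hQ : Qᵀ * Q = 1) {a b : Fin d → ℝ}
    (ha : (fromRows X₁ X₂)ᵀ * fromRows X₁ X₂ = Q * diagonal a * Qᵀ)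
    (hb : X₁ᵀ * X₁ = Q * diagonal b * Qᵀ) :
    ∑ y with Sum.isLeft y, U y ⬝ᵥ U y = ∑ i, b i / a i := by
  have hmul : ∀ f g : Fin d → ℝ, Q * diagonal f * Qᵀ * (Q * diagonal g * Qᵀ) =
      Q * diagonal (fun i => f i * g i) * Qᵀ := by
    intro f g
    rw [← diagonal_mul_diagonal]
    simp only [Matrix.mul_assoc]
    rw [← Matrix.mul_assoc Qᵀ Q, hQ, Matrix.one_mul]
  rw [h.sum_leverage_eq_trace (D := Q * diagonal (fun i => (a i)⁻¹) * Qᵀ), hb, hmul,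
    Matrix.mul_assoc, trace_mul_comm, Matrix.mul_assoc, hQ, Matrix.mul_one, trace_diagonal]
  · exact Finset.sum_congr rfl fun i _ => inv_mul_eq_div _ _
  · rw [ha, hmul, hmul]
    congr! 3
    ext i
    exact mul_inv_mul_cancel (a i)

end IsCompactSVD

theorem transpose_fromRows_mul_fromRows {n₁ n₂ d : ℕ} (X₁ : Matrix (Fin n₁) (Fin d) ℝ)
    (X₂ : Matrix (Fin n₂) (Fin d) ℝ) :
    (fromRows X₁ X₂)ᵀ * fromRows X₁ X₂ = X₁ᵀ * X₁ + X₂ᵀ * X₂ := by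
  rw [transpose_fromRows, fromCols_mul_fromRows]

theorem Matrix.IsHermitian.exists_orthogonal_diagonal {n : ℕ} {H : Matrix (Fin n) (Fin n) ℝ}
    (hH : H.IsHermitian) :
    ∃ Q : Matrix (Fin n) (Fin n) ℝ, Qᵀ * Q = 1 ∧ Q * Qᵀ = 1 ∧
      H = Q * diagonal hH.eigenvalues * Qᵀ := by
  refine ⟨hH.eigenvectorUnitary, ?_, ?_, ?_⟩
  · have := Unitary.coe_star_mul_self hH.eigenvectorUnitary
    simpa [star_eq_conjTranspose] using this
  · have := Unitary.coe_mul_star_self hH.eigenvectorUnitary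
    simpa [star_eq_conjTranspose] using this
  · have := hH.spectral_theorem
    rw [Unitary.conjStarAlgAut_apply] at this
    simpa [star_eq_conjTranspose, Function.comp_def] using this

theorem LinearMap.IsSymmetric.eigenvalues_congr {E : Type*} [NormedAddCommGroup E]
    [InnerProductSpace ℝ E] [FiniteDimensional ℝ E] {S T : E →ₗ[ℝ] E} (hS : S.IsSymmetric)
    (hT : T.IsSymmetric) (h : S = T) {n : ℕ} (hn : Module.finrank ℝ E = n) :
    hS.eigenvalues hn = hT.eigenvalues hn := by
  subst h; rfl

theorem rank_eq_finrank_range_toEuclideanLin {n d : ℕ} (X : Matrix (Fin n) (Fin d) ℝ) :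
    X.rank = Module.finrank ℝ (LinearMap.range (toEuclideanLin X)) := by
  rw [rank_eq_finrank_range_toLin X (PiLp.basisFun 2 ℝ _) (PiLp.basisFun 2 ℝ _),
    ← toLpLin_eq_toLin]

/-- The ordered eigenvalues of `XᵀX` are the squared singular values. Those beyond the rank are zero
and add `0` to the sum. -/
theorem statisticalDim_eq_sum {n d : ℕ} (X : Matrix (Fin n) (Fin d) ℝ) (lam : ℝ) :
    statisticalDim X lam = ∑ i, (isHermitian_conjTranspose_mul_self X).eigenvalues i /
      ((isHermitian_conjTranspose_mul_self X).eigenvalues i + lam) := by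
  set T := toEuclideanLin X
  have hrank := rank_eq_finrank_range_toEuclideanLin X
  have hle : X.rank ≤ Fintype.card (Fin d) := by simpa using rank_le_width X
  have hev : ∀ i, (isHermitian_conjTranspose_mul_self X).eigenvalues₀ i =
      T.singularValues i ^ 2 := by
    intro i
    rw [T.sq_singularValues_fin (n := Fintype.card (Fin d)) finrank_euclideanSpace,
      IsHermitian.eigenvalues₀]
    refine congr_fun (LinearMap.IsSymmetric.eigenvalues_congr _ _ ?_ _) i
    rw [← toEuclideanLin_conjTranspose_eq_adjoint]
    ext
    simp [T]
  have hsum : ∑ i, (isHermitian_conjTranspose_mul_self X).eigenvalues i /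
      ((isHermitian_conjTranspose_mul_self X).eigenvalues i + lam) =
      ∑ i : Fin (Fintype.card (Fin d)), T.singularValues i ^ 2 /
        (T.singularValues i ^ 2 + lam) := by
    refine Fintype.sum_equiv (Fintype.equivOfCardEq (Fintype.card_fin _)).symm _ _ fun i => ?_
    rw [IsHermitian.eigenvalues, hev]
  rw [hsum, Fin.sum_univ_eq_sum_range fun i => T.singularValues i ^ 2 /
    (T.singularValues i ^ 2 + lam), statisticalDim,
    ← Finset.sum_subset (Finset.range_subset_range.2 hle)]
  · refine Finset.sum_congr rfl fun i hi => ?_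
    rw [Finset.mem_range, hrank, ← T.singularValues_pos_iff_lt_finrank_range] at hi
    rw [one_add_div (by positivity), one_div_div]
  · intro i _ hi
    rw [Finset.mem_range, not_lt, hrank, ← T.singularValues_eq_zero_iff_le_finrank_range] at hi
    simp [hi]

/-- Expanding the fraction by `θ` exposes the eigenvalues `θ²` of `KᵀK` and `θ² + λθ` of `XᵀX`. -/
theorem effectiveDim_eq_sum {N : ℕ} {K : Matrix (Fin N) (Fin N) ℝ} (hK : K.IsHermitian) (lam : ℝ) :
    effectiveDim hK lam = ∑ i, hK.eigenvalues i ^ 2 /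
      (hK.eigenvalues i ^ 2 + lam * hK.eigenvalues i) := by
  rw [effectiveDim, Finset.sum_filter]
  refine Finset.sum_congr rfl fun i _ => ?_
  split_ifs with h
  · rw [one_add_div h, one_div_div, sq, ← add_mul, mul_div_mul_right _ _ h]
  · rw [not_not.1 h]; simp

theorem sum_leverage_eq_statisticalDim {n d r : ℕ} {X₁ : Matrix (Fin n) (Fin d) ℝ} {lam : ℝ}
    {U : Matrix (Fin n ⊕ Fin d) (Fin r) ℝ} {σ : Fin r → ℝ} {V : Matrix (Fin d) (Fin r) ℝ}
    (hlam : 0 ≤ lam)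
    (h : IsCompactSVD (fromRows X₁ (√lam • (1 : Matrix (Fin d) (Fin d) ℝ))) U σ V) :
    ∑ y with Sum.isLeft y, U y ⬝ᵥ U y = statisticalDim X₁ lam := by
  obtain ⟨Q, hQ, hQ', hH⟩ := (isHermitian_conjTranspose_mul_self X₁).exists_orthogonal_diagonal
  rw [statisticalDim_eq_sum]
  replace hH : X₁ᵀ * X₁ = Q * diagonal
      (isHermitian_conjTranspose_mul_self X₁).eigenvalues * Qᵀ := by
    rw [← conjTranspose_eq_transpose_of_trivial X₁]
    exact hH
  refine h.sum_leverage_of_diagonal hQ (a := fun i =>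
    (isHermitian_conjTranspose_mul_self X₁).eigenvalues i + lam) ?_ hH
  have h1 : (√lam • (1 : Matrix (Fin d) (Fin d) ℝ))ᵀ * (√lam • 1) = lam • 1 := by
    rw [transpose_smul, transpose_one, smul_mul_smul_comm, Real.mul_self_sqrt hlam, Matrix.mul_one]
  rw [transpose_fromRows_mul_fromRows, hH, h1, ← diagonal_add, Matrix.mul_add, Matrix.add_mul,
    ← smul_one_eq_diagonal, Matrix.mul_smul, Matrix.smul_mul, Matrix.mul_one, hQ']

theorem sum_leverage_eq_effectiveDim {N r : ℕ} {K Z : Matrix (Fin N) (Fin N) ℝ}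
    (hK : K.IsHermitian) {lam : ℝ} (hlam : 0 ≤ lam) (hZ : Zᵀ * Z = K)
    {U : Matrix (Fin N ⊕ Fin N) (Fin r) ℝ} {σ : Fin r → ℝ} {V : Matrix (Fin N) (Fin r) ℝ}
    (h : IsCompactSVD (fromRows K (√lam • Z)) U σ V) :
    ∑ y with Sum.isLeft y, U y ⬝ᵥ U y = effectiveDim hK lam := by
  obtain ⟨Q, hQ, hQ', hH⟩ := hK.exists_orthogonal_diagonal
  have hKt : Kᵀ = K := by rw [← conjTranspose_eq_transpose_of_trivial, hK.eq]
  have hKK : Kᵀ * K = Q * diagonal (fun i => hK.eigenvalues i ^ 2) * Qᵀ := by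
    rw [hKt]
    nth_rw 1 2 [hH]
    simp only [sq, ← diagonal_mul_diagonal, Matrix.mul_assoc]
    rw [← Matrix.mul_assoc Qᵀ Q, hQ, Matrix.one_mul]
  rw [effectiveDim_eq_sum]
  refine h.sum_leverage_of_diagonal hQ (a := fun i =>
    hK.eigenvalues i ^ 2 + lam * hK.eigenvalues i) ?_ hKK
  have h2 : lam • K = Q * diagonal (fun i => lam * hK.eigenvalues i) * Qᵀ := by
    conv_lhs => rw [hH]
    rw [← Matrix.smul_mul, ← Matrix.mul_smul, ← diagonal_smul]
    rfl
  rw [transpose_fromRows_mul_fromRows, hKK, ← diagonal_add, Matrix.mul_add, Matrix.add_mul, ← h2,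
    transpose_smul, smul_mul_smul_comm, Real.mul_self_sqrt hlam, hZ]

/-! ### From the state of the sampler to the guarantee. -/

namespace Asura

theorem sampledGram_output {ι : Type*} {r : ℕ} {U : Matrix ι (Fin r) ℝ} {γ : ℝ}
    {s : AsuraState ι r} (h : Reachable U γ s) :
    sampledGram U (output s) = (1 / mid s) • s.A := by
  rw [h.A_eq, List.smul_sum, List.map_map, sampledGram, output, List.map_map]
  refine congrArg List.sum (List.map_congr_left fun q _ => ?_)
  rw [Function.comp_apply, Function.comp_apply, smul_smul, one_div_mul_eq_div]

theorem sampledCorrelation_output {ι : Type*} {r : ℕ} (U : Matrix ι (Fin r) ℝ) (e : ι → ℝ)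
    (s : AsuraState ι r) :
    sampledCorrelation U e (output s) = (1 / mid s) • sampleSum U e s := by
  rw [sampleSum, List.smul_sum, List.map_map, sampledCorrelation, output, List.map_map]
  refine congrArg List.sum (List.map_congr_left fun q _ => ?_)
  rw [Function.comp_apply, Function.comp_apply, smul_smul]
  congr 1
  ring

/-- `G = A/mid ≥ l/mid`, and the gap `4r/γ + 4γ mid` is at most `(16γ/q² + 4γ) mid ≤ (4/5 + 1/5)
mid`, so `l ≥ mid/2`. -/
theorem half_le_quad_sampledGram {ι : Type*} {r : ℕ} [NeZero r] {U : Matrix ι (Fin r) ℝ} {γ q : ℝ}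
    {s : AsuraState ι r} (hγ : 0 < γ) (hq : 0 < q) (hq1 : q ≤ 1) (hγq : γ ≤ q ^ 2 / 20)
    (h : Reachable U γ s) (hmid : q ^ 2 / 4 * (r / γ ^ 2) ≤ mid s) (δ : Fin r → ℝ) :
    1 / 2 * (δ ⬝ᵥ δ) ≤ δ ⬝ᵥ sampledGram U (output s) *ᵥ δ := by
  have hr : (0 : ℝ) < r := by exact_mod_cast NeZero.pos r
  have hm : 0 < mid s := lt_of_lt_of_le (by positivity) hmid
  have h0 : 0 ≤ δ ⬝ᵥ δ := by simpa using dotProduct_star_self_nonneg δ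
  have h1 := h.balanced.lower.quad_nonneg δ
  have h2 : δ ⬝ᵥ (s.A - s.l • (1 : Matrix (Fin r) (Fin r) ℝ)) *ᵥ δ =
      δ ⬝ᵥ s.A *ᵥ δ - s.l * (δ ⬝ᵥ δ) := by
    simp [sub_mulVec, smul_mulVec, dotProduct_sub]
  have h3 : s.l = mid s - (s.u - s.l) / 2 := by rw [mid]; ring
  have h4 : 4 * r / γ ≤ 16 * γ / q ^ 2 * mid s := by
    refine le_trans (le_of_eq ?_) (mul_le_mul_of_nonneg_left hmid
      (show 0 ≤ 16 * γ / q ^ 2 by positivity))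
    field_simp
    norm_num
  have h5 : 16 * γ / q ^ 2 ≤ 4 / 5 := by
    rw [div_le_iff₀ (by positivity)]; linarith
  have h6 : γ ≤ 1 / 20 := by nlinarith
  have h7 : 1 / 2 * mid s ≤ s.l := by
    rw [h3, h.gap]
    nlinarith
  rw [sampledGram_output h, smul_mulVec, dotProduct_smul, smul_eq_mul, one_div (mid s),
    le_inv_mul_iff₀ hm]
  nlinarith

theorem labelQueries_output {n₁ n₂ r : ℕ} (s : AsuraState (Fin n₁ ⊕ Fin n₂) r) :
    labelQueries (output s) = s.samples.countP fun w => w.1.isLeft := by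
  rw [labelQueries, output, List.countP_map]
  rfl

/-- With `γ² = ε/C₀²`, the three summands of the constant pay for the approximation, the queries and
the support, in this order. -/
theorem ofReal_le_outputProb_isGoodOutput {p q C₀ : ℝ} (hq : 0 < q) (hq1 : q ≤ 1)
    (hpq : p + 3 * q ≤ 1) (hC₀ : 20 / q ^ 2 ≤ C₀) {n₁ n₂ d r : ℕ}
    {X : Matrix (Fin n₁ ⊕ Fin n₂) (Fin d) ℝ} (Y : Fin n₁ ⊕ Fin n₂ → ℝ)
    {U : Matrix (Fin n₁ ⊕ Fin n₂) (Fin r) ℝ} {σ : Fin r → ℝ} {V : Matrix (Fin d) (Fin r) ℝ}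
    (h : IsCompactSVD X U σ V) {ε : ℝ} (hε : 0 < ε) (hε1 : ε < 1) :
    ENNReal.ofReal p ≤ outputProb U (√ε / C₀) (fun s =>
      IsGoodOutput X Y (fun β => sqNorm (X *ᵥ β - Y)) (∑ y with Sum.isLeft y, U y ⬝ᵥ U y)
        (640 / (q ^ 5 * C₀ ^ 2) + 4 * C₀ ^ 2 / q + 2 * C₀ ^ 2) ε (output s)) := by
  have hq2 : q ^ 2 ≤ 1 := by nlinarith
  have h20 : 20 ≤ q ^ 2 * C₀ := by rwa [div_le_iff₀' (by positivity)] at hC₀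
  have hC : 20 ≤ C₀ := by nlinarith [(by positivity : 0 ≤ 20 / q ^ 2).trans hC₀]
  have hC0 : 0 < C₀ := by linarith
  set γ := √ε / C₀ with hγdef
  have hγ : 0 < γ := by positivity
  have hγ2 : γ ^ 2 = ε / C₀ ^ 2 := by rw [hγdef, div_pow, Real.sq_sqrt hε.le]
  have hγq : γ ≤ q ^ 2 / 20 := by
    rw [hγdef, div_le_div_iff₀ hC0 (by norm_num)]
    have : √ε ≤ 1 := Real.sqrt_le_one.2 hε1.le
    linarith
  set C := 640 / (q ^ 5 * C₀ ^ 2) + 4 * C₀ ^ 2 / q + 2 * C₀ ^ 2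
  have c1 : 640 / (q ^ 5 * C₀ ^ 2) ≤ C := by
    have : 0 ≤ 4 * C₀ ^ 2 / q + 2 * C₀ ^ 2 := by positivity
    linarith
  have c2 : 4 * C₀ ^ 2 / q ≤ C := by
    have : 0 ≤ 640 / (q ^ 5 * C₀ ^ 2) + 2 * C₀ ^ 2 := by positivity
    linarith
  have c3 : 2 * C₀ ^ 2 ≤ C := by
    have : 0 ≤ 640 / (q ^ 5 * C₀ ^ 2) + 4 * C₀ ^ 2 / q := by positivity
    linarith
  have hCpos : 0 ≤ C := le_trans (by positivity) c3
  have hRpos : 0 ≤ ∑ y with Sum.isLeft y, U y ⬝ᵥ U y :=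
    Finset.sum_nonneg fun y _ => by simpa using dotProduct_star_self_nonneg (U y)
  rcases Nat.eq_zero_or_pos r with rfl | hr
  -- For `r = 0` the loop condition reads `0 < 0`, so the sampler returns the empty list at once.
  · have hterm : ¬ Continues γ (init (Fin n₁ ⊕ Fin n₂) 0 γ) := by simp [Continues, init]
    have hgood : IsGoodOutput X Y (fun β => sqNorm (X *ᵥ β - Y))
        (∑ y with Sum.isLeft y, U y ⬝ᵥ U y) C ε (output (init (Fin n₁ ⊕ Fin n₂) 0 γ)) := by
      have hout : output (init (Fin n₁ ⊕ Fin n₂) 0 γ) = [] := rfl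
      rw [hout]
      refine isGoodOutput_of_sampledGram h (c := 0) (by simp) (fun δ => by simp) (by simp)
        (by simp; positivity) (by positivity) ?_ ?_
      · simp only [labelQueries, List.countP_nil, Nat.cast_zero]; positivity
      · simp only [List.length_nil, Nat.cast_zero]; positivity
    refine le_trans ?_ (le_iSup _ 0)
    rw [stateAfter, PMF.toOuterMeasure_pure_apply, if_pos ⟨_, rfl, hterm, hgood⟩]
    exact ENNReal.ofReal_le_one.2 (by linarith)
  have : NeZero r := ⟨hr.ne'⟩
  have hr1 : (1 : ℝ) ≤ r := by exact_mod_cast hr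
  refine ofReal_le_outputProb h.orthonormal_left hγ (by linarith) hq hq1 hpq ?_ Sum.isLeft
    (h.transpose_mulVec_residual Y) fun s hs _ hmid hlen hcount hsum => ?_
  · have h1 : C₀ ^ 2 ≤ r / γ ^ 2 := by
      rw [hγ2, div_div_eq_mul_div, le_div_iff₀ hε]
      nlinarith [pow_pos hC0 2]
    refine le_trans ?_ (mul_le_mul_of_nonneg_left h1 hq.le)
    nlinarith [mul_le_mul_of_nonneg_left hq1 hq.le]
  have hm : 0 < mid s := lt_of_lt_of_le (by positivity) hmid
  have hrd : (r : ℝ) ≤ d := by exact_mod_cast h.le_dim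
  -- The product of `1/mid² ≤ 16γ⁴/(q⁴r²)` and the second moment factor `5r²/(2qγ²)`.
  refine isGoodOutput_of_sampledGram h (c := 40 * γ ^ 2 / q ^ 5) ?_
    (half_le_quad_sampledGram hγ hq hq1 hγq hs hmid) ?_ ?_ (by positivity) ?_ ?_
  · intro w hw
    obtain ⟨v, hv, rfl⟩ := List.mem_map.1 hw
    exact div_nonneg (hs.weight_nonneg v hv) hm.le
  · rw [sampledCorrelation_output, smul_dotProduct, dotProduct_smul, smul_eq_mul, smul_eq_mul,
      ← mul_assoc]
    have h1 : 1 / mid s * (1 / mid s) ≤ 16 * γ ^ 4 / (q ^ 4 * r ^ 2) := by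
      have h2 : 1 / mid s ≤ 4 * γ ^ 2 / (q ^ 2 * r) := by
        refine (one_div_le_one_div_of_le (by positivity) hmid).trans_eq ?_
        field_simp
      refine (mul_le_mul h2 h2 (by positivity) (by positivity)).trans_eq ?_
      field_simp
      norm_num
    refine (mul_le_mul h1 hsum (by simpa using dotProduct_star_self_nonneg (sampleSum U _ s))
      (by positivity)).trans_eq ?_
    rw [sqNorm]
    field_simp
    ring
  · rw [hγ2]
    refine le_trans (le_of_eq ?_) (mul_le_mul_of_nonneg_right c1 hε.le)
    field_simp
    norm_num
  · rw [labelQueries_output]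
    refine hcount.trans (le_trans (le_of_eq ?_) (mul_le_mul_of_nonneg_right c2
      (show 0 ≤ (∑ y with Sum.isLeft y, U y ⬝ᵥ U y) / ε by positivity)))
    rw [hγ2]
    field_simp
  · rw [output, List.length_map]
    refine hlen.trans (le_trans ?_ (mul_le_mul_of_nonneg_right c3
      (show 0 ≤ (d : ℝ) / ε by positivity)))
    rw [hγ2, div_div_eq_mul_div]
    have : (r : ℝ) / ε ≤ d / ε := div_le_div_of_nonneg_right hrd hε.le
    have := mul_le_mul_of_nonneg_left this (show 0 ≤ 2 * C₀ ^ 2 by positivity)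
    refine le_trans (le_of_eq ?_) this
    ring

end Asura

/-! ### Splitting the ridge losses, and the main theorem. -/

theorem sqNorm_sumElim {m n : Type*} [Fintype m] [Fintype n] (v : m → ℝ) (w : n → ℝ) :
    sqNorm (Sum.elim v w) = sqNorm v + sqNorm w := by
  simp [sqNorm]

theorem sqNorm_smul {n : Type*} [Fintype n] (c : ℝ) (v : n → ℝ) :
    sqNorm (c • v) = c ^ 2 * sqNorm v := by
  simp [sqNorm, mul_pow, Finset.mul_sum]

theorem sqNorm_fromRows_mulVec_sub {n₁ n₂ d : ℕ} (X₁ : Matrix (Fin n₁) (Fin d) ℝ)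
    (X₂ : Matrix (Fin n₂) (Fin d) ℝ) (Y₁ : Fin n₁ → ℝ) (β : Fin d → ℝ) :
    sqNorm (fromRows X₁ X₂ *ᵥ β - Sum.elim Y₁ 0) = sqNorm (X₁ *ᵥ β - Y₁) + sqNorm (X₂ *ᵥ β) := by
  rw [← sqNorm_sumElim, fromRows_mulVec]
  congr 1
  ext (i | i) <;> simp

theorem mainTheorem1 (p : ℝ) (hp₀ : 0 < p) (hp₁ : p < 1) :
    ∃ Cmin : ℝ, 0 < Cmin ∧ ∀ C₀ : ℝ, Cmin ≤ C₀ → ∃ C : ℝ, 0 < C ∧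
      -- semi-supervised active regression
      (∀ (n₁ n₂ d r : ℕ) (X₁ : Matrix (Fin n₁) (Fin d) ℝ) (X₂ : Matrix (Fin n₂) (Fin d) ℝ)
        (Y₁ : Fin n₁ → ℝ) (Y₂ : Fin n₂ → ℝ)
        (U : Matrix (Fin n₁ ⊕ Fin n₂) (Fin r) ℝ) (σ : Fin r → ℝ) (V : Matrix (Fin d) (Fin r) ℝ)
        (ε : ℝ), 0 < ε → ε < 1 →
        IsUnit ((Matrix.fromRows X₁ X₂)ᵀ * Matrix.fromRows X₁ X₂).det →
        IsCompactSVD (Matrix.fromRows X₁ X₂) U σ V →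
        ENNReal.ofReal p ≤ Asura.outputProb U (√ε / C₀) (fun s =>
          IsGoodOutput (Matrix.fromRows X₁ X₂) (Sum.elim Y₁ Y₂)
            (fun β => sqNorm (Matrix.fromRows X₁ X₂ *ᵥ β - Sum.elim Y₁ Y₂))
            (reducedRank X₁ X₂) C ε (Asura.output s))) ∧
      -- active ridge regression
      (∀ (n d r : ℕ) (X₁ : Matrix (Fin n) (Fin d) ℝ) (Y₁ : Fin n → ℝ) (lam : ℝ)
        (U : Matrix (Fin n ⊕ Fin d) (Fin r) ℝ) (σ : Fin r → ℝ) (V : Matrix (Fin d) (Fin r) ℝ)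
        (ε : ℝ), 0 < ε → ε < 1 → 0 ≤ lam →
        IsCompactSVD (Matrix.fromRows X₁ (√lam • (1 : Matrix (Fin d) (Fin d) ℝ))) U σ V →
        ENNReal.ofReal p ≤ Asura.outputProb U (√ε / C₀) (fun s =>
          IsGoodOutput (Matrix.fromRows X₁ (√lam • (1 : Matrix (Fin d) (Fin d) ℝ)))
            (Sum.elim Y₁ 0)
            (fun β => sqNorm (X₁ *ᵥ β - Y₁) + lam * sqNorm β)
            (statisticalDim X₁ lam) C ε (Asura.output s))) ∧
      -- active kernel ridge regression
      (∀ (N r : ℕ) (K Z : Matrix (Fin N) (Fin N) ℝ) (hK : K.PosSemidef) (Y₁ : Fin N → ℝ) (lam : ℝ)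
        (U : Matrix (Fin N ⊕ Fin N) (Fin r) ℝ) (σ : Fin r → ℝ) (V : Matrix (Fin N) (Fin r) ℝ)
        (ε : ℝ), 0 < ε → ε < 1 → 0 ≤ lam → Zᵀ * Z = K →
        IsCompactSVD (Matrix.fromRows K (√lam • Z)) U σ V →
        ENNReal.ofReal p ≤ Asura.outputProb U (√ε / C₀) (fun s =>
          IsGoodOutput (Matrix.fromRows K (√lam • Z)) (Sum.elim Y₁ 0)
            (fun β => sqNorm (K *ᵥ β - Y₁) + lam * (β ⬝ᵥ K *ᵥ β))
            (effectiveDim hK.isHermitian lam) C ε (Asura.output s))) := by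
  -- Each of the three bad events gets a third of the allowed failure probability.
  obtain ⟨q, hq, hq1, hpq⟩ : ∃ q : ℝ, 0 < q ∧ q ≤ 1 ∧ p + 3 * q ≤ 1 :=
    ⟨(1 - p) / 3, by linarith, by linarith, by linarith⟩
  -- As `ε < 1`, this threshold ensures `γ ≤ q²/20`, as the Gram bound requires.
  refine ⟨20 / q ^ 2, by positivity, fun C₀ hC₀ => ?_⟩
  have hC : 0 < C₀ := lt_of_lt_of_le (by positivity) hC₀
  refine ⟨640 / (q ^ 5 * C₀ ^ 2) + 4 * C₀ ^ 2 / q + 2 * C₀ ^ 2, by positivity, ?_, ?_, ?_⟩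
  · intro n₁ n₂ d r X₁ X₂ Y₁ Y₂ U σ V ε hε hε1 hX h
    rw [← h.sum_leverage_eq_reducedRank hX]
    exact Asura.ofReal_le_outputProb_isGoodOutput hq hq1 hpq hC₀ _ h hε hε1
  · intro n d r X₁ Y₁ lam U σ V ε hε hε1 hlam h
    have hloss : (fun β => sqNorm (X₁ *ᵥ β - Y₁) + lam * sqNorm β) = fun β =>
        sqNorm (fromRows X₁ (√lam • (1 : Matrix (Fin d) (Fin d) ℝ)) *ᵥ β - Sum.elim Y₁ 0) := by
      ext β
      rw [sqNorm_fromRows_mulVec_sub, smul_mulVec, one_mulVec, sqNorm_smul, Real.sq_sqrt hlam]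
    rw [← sum_leverage_eq_statisticalDim hlam h, hloss]
    exact Asura.ofReal_le_outputProb_isGoodOutput hq hq1 hpq hC₀ _ h hε hε1
  · intro N r K Z hK Y₁ lam U σ V ε hε hε1 hlam hZ h
    have hloss : (fun β => sqNorm (K *ᵥ β - Y₁) + lam * (β ⬝ᵥ K *ᵥ β)) = fun β =>
        sqNorm (fromRows K (√lam • Z) *ᵥ β - Sum.elim Y₁ 0) := by
      ext β
      rw [sqNorm_fromRows_mulVec_sub, smul_mulVec, sqNorm_smul, Real.sq_sqrt hlam,
        sqNorm_eq_dotProduct (Z *ᵥ β), ← hZ, ← mulVec_mulVec, dotProduct_mulVec β,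
        vecMul_transpose]
    rw [← sum_leverage_eq_effectiveDim hK.isHermitian hlam hZ h, hloss]
    exact Asura.ofReal_le_outputProb_isGoodOutput hq hq1 hpq hC₀ _ h hε hε1
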